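/- **Setting.** Let $V$ be a finite-dimensional real vector space, $(\alpha_i)_{i\in I}$ a finite linearly independent family in $V^*$ and $(\alpha_i^\vee)_{i\in I}$ a family in $V$ with $\alpha_i(\alpha_i^\vee)=2$; put $r_i(v)=v-\alpha_i(v)\alpha_i^\vee$, $W^v=\langle r_i\mid i\in I\rangle\subset GL(V)$ (acting on $V^*$ by $w\alpha=\alpha\circ w^{-1}$) and $\Phi=\{w\alpha_i\mid w\in W^v,\ i\in I\}$ (the real roots). Assume that $(W^v,(r_i))$ is a Coxeter system with length $\ell$; that for $\alpha=w\alpha_i\in\Phi$ the reflection $r_\alpha=wr_iw^{-1}$ depends only on $\alpha$; that every root in $\Phi$ is positive, i.e. in $Q_+=\sum_i\mathbb R_{\ge0}\alpha_i$, or negative, i.e. in $-Q_+$; that $w\alpha_i\in Q_+\Leftrightarrow \ell(wr_i)>\ell(w)$; and that $\Phi\cap\mathbb R_{>0}\alpha=\{\alpha\}$ for $\alpha\in\Phi$. Let $\Delta_{im}\subset V^*$ (imaginary roots) be disjoint from $\mathbb R\Phi$ and stable under $\pm W^v$, and moderately imaginary: $\Delta_{im}\subset Q_+\cup -Q_+$,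 and $\Delta_{im}\cap Q_+$ is stable under $W^v$. Put $\Delta=\Phi\cup\Delta_{im}$. For $J\subset I$ let $F^v(J)=\{v\mid \alpha_i(v)=0\ (i\in J),\ \alpha_i(v)>0\ (i\notin J)\}$. The vectorial facets are the sets $\pm wF^v(J)$ with $w\in W^v$; such a facet is spherical if $\langle r_i\mid i\in J\rangle$ is finite. The Tits cone is $\mathcal T=\bigcup_{w,J}wF^v(J)$, and $\mathcal T^\circ$ is its interior. Let $\mathbb A$ be an affine space under $V$ with a set $\mathcal M$ of affine hyperplanes (walls), each with direction $\ker\alpha$ for some $\alpha\in\Phi$, such that for each $\alpha\in\Phi$ infinitely many walls have direction $\ker\alpha$, and such that $\mathcal M$ is stable under the group $W$ generated by the affine reflections $r_M$ ($M\in\mathcal M$) with hyperplane $M$ and linear part $r_\alpha$, where $\ker\alpha$ is the direction of $M$. For $p,q\in\mathbb A$ write $p\le q$ if $q-p\in\mathcal T$ and $p\mathrel{\overset{\circ}{\le}}q$ if $q-p\in\mathcal T^\circ\cup\{0\}$. Subsets of a set are identified with the filters that they generate; a set (or filter) contains a filter $F$ if it belongs to $F$ (resp. all its elements do). The union $F\cup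 F'$ of two filters consists of the sets belonging to both. A map fixes a filter if it fixes pointwise some element of it. For $\alpha\in\Delta$, an $\alpha$-half-space is $\mathbb A$ or a half-space $\{a\mid\alpha(a-p)\ge0\}$, where $p\in\mathbb A$ and, if $\alpha\in\Phi$, $p+\ker\alpha\in\mathcal M$; open $\alpha$-half-spaces are $\mathbb A$ and the sets obtained with $>$ instead of $\ge$. The enclosure $cl(F)$ of a filter $F$ consists of the sets containing an element of $F$ that is an intersection of $\alpha$-half-spaces, one for each $\alpha\in\Delta$. The facet $F(x,F^v)$, for $x\in\mathbb A$ and a vectorial facet $F^v$, consists of the sets containing an intersection of closed or open $\alpha$-half-spaces, one for each $\alpha\in\Delta$, that contains a neighbourhood of $x$ in $x+F^v$. The chimney with base a facet $F$ and direction a vectorial facet $F^v$ is $cl(F+F^v)$; its germ consists of the sets containing $cl(F+\xi+F^v)$ for some $\xi\in\overline{F^v}$. The chimney is splayed if $F^v$ is spherical, and solid if the direction of its support (the smallest affine subspace containing it) has a finite pointwise fixer in $W^v$. For $p\ne q$, the germ at $p$ of the interval $]p,q]$ is preordered if $p\le q$ or $q\le p$, and the half-line from $p$ through $q$ is generic if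 $p\mathrel{\overset{\circ}{\le}}q$ or $q\mathrel{\overset{\circ}{\le}}p$. An apartment of type $\mathbb A$ is a set $A$ with a nonempty set of bijections $\mathbb A\to A$ that is of the form $f_0\circ W$ for each of its elements $f_0$; an isomorphism $A\to A'$ is a bijection carrying such bijections for $A$ to such bijections for $A'$. All the notions above are invariant under $W$, so they make sense in $A$; an index $A$ marks them. An affine hovel of type $\mathbb A$ is a set $\mathcal I$ covered by a set of subsets, called apartments, such that: (MA1) each apartment has a structure of apartment of type $\mathbb A$; (MA2) if $F$ is a point, a germ of preordered interval, a generic half-line or a solid chimney of an apartment $A$, and $A'$ is an apartment containing $F$, then $A\cap A'$ contains $cl_A(F)$ and some isomorphism $A\to A'$ fixes $cl_A(F)$; (MA3) if $\mathfrak R$ is a germ of a splayed chimney (of some apartment) and $F$ a facet or a germ of a solid chimney (of some apartment), then some apartment contains $\mathfrak R$ and $F$; (MA4) if two apartments $A,A'$ contain $\mathfrak R$ and $F$ as in (MA3), then $A\cap A'$ contains $cl_A(\mathfrak R\cup F)$ and some isomorphism $A\to A'$ fixes $cl_A(\mathfrak R\cup F)$. It is ordered if moreover (MAO) for all $x,y\in\mathcal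 I$ and apartments $A,A'$ containing both, $x\le_Ay$ implies $[x,y]_A=[x,y]_{A'}$. **Statement.** Let $\mathcal I$ be an ordered affine hovel of type $\mathbb A$. Let $A_1,A_2$ be apartments and $x\neq y$ two points of $A_1\cap A_2$ with $x\le_{A_1}y$ (respectively $x\mathrel{\overset{\circ}{\le}}_{A_1}y$). Then $x\le_{A_2}y$ (respectively $x\mathrel{\overset{\circ}{\le}}_{A_2}y$), and there is an isomorphism $A_1\to A_2$ which fixes the enclosure $cl_{A_1}([x,y]_{A_1})$. Consequently the relations $\le$ and $\overset{\circ}{\le}$ on $\mathcal I$, where $x\le y$ (respectively $x\mathrel{\overset{\circ}{\le}}y$) means that $x\le_Ay$ (respectively $x\mathrel{\overset{\circ}{\le}}_Ay$) for some apartment $A$ containing $x$ and $y$, are well defined: for every apartment $A$ and all $x,y\in A$ one has $x\le y\Leftrightarrow x\le_Ay$ and $x\mathrel{\overset{\circ}{\le}}y\Leftrightarrow x\mathrel{\overset{\circ}{\le}}_Ay$. -/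

import Mathlib

open Set Filter Topology Module

noncomputable section

namespace Hovel

/-- A finite family of simple roots and coroots in a real vector space. -/
structure SimpleRoots (V I : Type*) [AddCommGroup V] [Module ℝ V] where
  /-- the simple roots `α i` -/
  root : I → Dual ℝ V
  /-- the simple coroots -/
  coroot : I → V
  root_independent : LinearIndependent ℝ root
  root_coroot_two : ∀ i, root i (coroot i) = 2

namespace SimpleRoots

variable {V I : Type*} [AddCommGroup V] [Module ℝ V] (R : SimpleRoots V I)

/-- The simple reflection `v ↦ v - α i (v) • αᵛ i`. -/
def simpleReflection (i : I) : V ≃ₗ[ℝ] V := Module.reflection (R.root_coroot_two i)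

/-- The subgroup `Wᵛ(J)` generated by the simple reflections with index in `J`. -/
def parabolic (J : Set I) : Subgroup (V ≃ₗ[ℝ] V) :=
  Subgroup.closure (R.simpleReflection '' J)

/-- The vectorial Weyl group `Wᵛ`. -/
def vectorialWeyl : Subgroup (V ≃ₗ[ℝ] V) :=
  Subgroup.closure (Set.range R.simpleReflection)

/-- A simple reflection, as an element of the vectorial Weyl group. -/
def simpleReflectionW (i : I) : R.vectorialWeyl :=
  ⟨R.simpleReflection i, Subgroup.subset_closure (Set.mem_range_self i)⟩

/-- The real roots: the forms `w (α i)`, with `w` in `Wᵛ`. -/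
def realRoots : Set (Dual ℝ V) :=
  {α | ∃ w ∈ R.vectorialWeyl, ∃ i, α = R.root i ∘ₗ (w.symm : V →ₗ[ℝ] V)}

/-- The cone of linear combinations of the simple roots with nonnegative coefficients. -/
def positiveCone [Fintype I] : Set (Dual ℝ V) :=
  {β | ∃ c : I → ℝ, (∀ i, 0 ≤ c i) ∧ β = ∑ i, c i • R.root i}

/-- The face `Fᵛ(J)` of the fundamental chamber: `α i = 0` for `i` in `J` and `α i > 0`
for the other `i`. -/
def stdFacet (J : Set I) : Set V :=
  {v | (∀ i ∈ J, R.root i v = 0) ∧ ∀ i ∉ J, 0 < R.root i v}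

/-- Vectorial facets, positive (`w Fᵛ(J)`) or negative (`- w Fᵛ(J)`). -/
def IsVectorialFacet (F : Set V) : Prop :=
  ∃ w ∈ R.vectorialWeyl, ∃ J : Set I,
    F = w '' R.stdFacet J ∨ F = (fun v => -w v) '' R.stdFacet J

/-- Spherical vectorial facets: those of type `J` with `Wᵛ(J)` finite. -/
def IsSphericalFacet (F : Set V) : Prop :=
  ∃ w ∈ R.vectorialWeyl, ∃ J : Set I, Finite (R.parabolic J) ∧
    (F = w '' R.stdFacet J ∨ F = (fun v => -w v) '' R.stdFacet J)

/-- The Tits cone: the union of the positive vectorial facets. -/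
def titsCone : Set V :=
  {v | ∃ w ∈ R.vectorialWeyl, ∃ J : Set I, v ∈ w '' R.stdFacet J}

end SimpleRoots

/-- The vectorial data: simple roots and coroots whose reflections generate a Coxeter group
`Wᵛ`, such that every real root is positive or negative, together with a set of imaginary
roots. -/
structure VectorialDatum (V I : Type*) [AddCommGroup V] [Module ℝ V] [Fintype I] extends
    SimpleRoots V I where
  /-- the Coxeter matrix of `Wᵛ` -/
  coxeterMatrix : CoxeterMatrix I
  /-- `Wᵛ` is a Coxeter group on the simple reflections -/
  coxeterSystem : CoxeterSystem coxeterMatrix toSimpleRoots.vectorialWeyl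
  coxeter_simple : ∀ i, coxeterSystem.simple i = toSimpleRoots.simpleReflectionW i
  /-- the reflection `w rᵢ w⁻¹` depends only on the root `w (α i)` -/
  reflection_wellDefined : ∀ w ∈ toSimpleRoots.vectorialWeyl,
    ∀ w' ∈ toSimpleRoots.vectorialWeyl, ∀ i j,
      root i ∘ₗ (w.symm : V →ₗ[ℝ] V) = root j ∘ₗ (w'.symm : V →ₗ[ℝ] V) →
      w * toSimpleRoots.simpleReflection i * w⁻¹ =
        w' * toSimpleRoots.simpleReflection j * w'⁻¹
  /-- every real root is positive or negative -/
  pos_or_neg : ∀ α ∈ toSimpleRoots.realRoots,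
    α ∈ toSimpleRoots.positiveCone ∨ -α ∈ toSimpleRoots.positiveCone
  /-- `w (α i)` is positive if and only if `w rᵢ` is longer than `w` -/
  pos_iff_length : ∀ (w : toSimpleRoots.vectorialWeyl) (i : I),
    root i ∘ₗ ((w : V ≃ₗ[ℝ] V).symm : V →ₗ[ℝ] V) ∈ toSimpleRoots.positiveCone ↔
      coxeterSystem.length w <
        coxeterSystem.length (w * toSimpleRoots.simpleReflectionW i)
  /-- the only positive multiple of a real root that is a real root is the root itself -/
  reduced : ∀ α ∈ toSimpleRoots.realRoots, ∀ c : ℝ, 0 < c →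
    c • α ∈ toSimpleRoots.realRoots → c = 1
  /-- the imaginary roots -/
  imRoots : Set (Dual ℝ V)
  imRoots_disjoint : ∀ β ∈ imRoots, ∀ α ∈ toSimpleRoots.realRoots, ∀ c : ℝ, β ≠ c • α
  imRoots_neg : ∀ β ∈ imRoots, -β ∈ imRoots
  imRoots_weyl : ∀ w ∈ toSimpleRoots.vectorialWeyl, ∀ β ∈ imRoots,
    β ∘ₗ (w.symm : V →ₗ[ℝ] V) ∈ imRoots

namespace VectorialDatum

variable {V I : Type*} [AddCommGroup V] [Module ℝ V] [Fintype I] (D : VectorialDatum V I)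

/-- All roots, real or imaginary. -/
def roots : Set (Dual ℝ V) := D.realRoots ∪ D.imRoots

/-- The moderately imaginary case: every imaginary root is positive or negative, and the set of
positive imaginary roots is stable under `Wᵛ`. -/
def ModeratelyImaginary : Prop :=
  (∀ β ∈ D.imRoots, β ∈ D.positiveCone ∨ -β ∈ D.positiveCone) ∧
  ∀ w ∈ D.vectorialWeyl, ∀ β ∈ D.imRoots, β ∈ D.positiveCone →
    β ∘ₗ (w.symm : V →ₗ[ℝ] V) ∈ D.positiveCone

end VectorialDatum

/-- The affine reflections `r_M`: the reflection with hyperplane `M` whose linear part is `r_α`,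
for a hyperplane `M` in `walls` and a real root `α` such that `M` has direction `ker α`. -/
def wallReflections {V 𝔸 I : Type*} [AddCommGroup V] [Module ℝ V] [AddTorsor V 𝔸]
    (R : SimpleRoots V I) (walls : Set (AffineSubspace ℝ 𝔸)) : Set (𝔸 ≃ᵃ[ℝ] 𝔸) :=
  {g | ∃ M ∈ walls, ∃ w ∈ R.vectorialWeyl, ∃ i,
    M.direction = LinearMap.ker (R.root i ∘ₗ (w.symm : V →ₗ[ℝ] V)) ∧
    g.linear = w * R.simpleReflection i * w⁻¹ ∧ ∀ p ∈ M, g p = p}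

/-- The model apartment: an affine space `𝔸` under `V` with a set of (real) walls. -/
structure ModelApartment (V 𝔸 I : Type*) [AddCommGroup V] [Module ℝ V] [AddTorsor V 𝔸]
    [Fintype I] extends VectorialDatum V I where
  /-- the real walls -/
  walls : Set (AffineSubspace ℝ 𝔸)
  wall_nonempty : ∀ M ∈ walls, (M : Set 𝔸).Nonempty
  wall_direction : ∀ M ∈ walls, ∃ α ∈ toSimpleRoots.realRoots, M.direction = LinearMap.ker α
  infinite_walls : ∀ α ∈ toSimpleRoots.realRoots,
    {M ∈ walls | M.direction = LinearMap.ker α}.Infinite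
  walls_stable : ∀ g ∈ Subgroup.closure (wallReflections toSimpleRoots walls),
    ∀ M ∈ walls, M.map (g : 𝔸 →ᵃ[ℝ] 𝔸) ∈ walls

namespace ModelApartment

variable {V 𝔸 I : Type*} [NormedAddCommGroup V] [NormedSpace ℝ V] [MetricSpace 𝔸]
  [NormedAddTorsor V 𝔸] [Fintype I] (D : ModelApartment V 𝔸 I)

/-- The affine Weyl group `W`. -/
def weyl : Subgroup (𝔸 ≃ᵃ[ℝ] 𝔸) :=
  Subgroup.closure (wallReflections D.toSimpleRoots D.walls)

/-- The hyperplane through `p` with direction `ker α` is a wall, real if `α` is a real root and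
imaginary if `α` is an imaginary root (every such hyperplane is then an imaginary wall). -/
def IsWallAt (α : Dual ℝ V) (p : 𝔸) : Prop :=
  (α ∈ D.realRoots ∧ AffineSubspace.mk' p (LinearMap.ker α) ∈ D.walls) ∨ α ∈ D.imRoots

/-- The sets `D(α, k)`: closed half-spaces bounded by a wall, or the whole of `𝔸`. -/
def IsHalfSpace (α : Dual ℝ V) (H : Set 𝔸) : Prop :=
  H = univ ∨ ∃ p, D.IsWallAt α p ∧ H = {a | 0 ≤ α (a -ᵥ p)}

/-- The sets `D°(α, k)`: open half-spaces bounded by a wall, or the whole of `𝔸`. -/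
def IsOpenHalfSpace (α : Dual ℝ V) (H : Set 𝔸) : Prop :=
  H = univ ∨ ∃ p, D.IsWallAt α p ∧ H = {a | 0 < α (a -ᵥ p)}

/-- Intersections over all roots `α` of closed half-spaces `D(α, k_α)`. -/
def IsClosedCell (E : Set 𝔸) : Prop :=
  ∃ H : Dual ℝ V → Set 𝔸, (∀ α ∈ D.roots, D.IsHalfSpace α (H α)) ∧ E = ⋂ α ∈ D.roots, H α

/-- Intersections over all roots `α` of half-spaces `D(α, k_α)` or `D°(α, k_α)`. -/
def IsCell (E : Set 𝔸) : Prop :=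
  ∃ H : Dual ℝ V → Set 𝔸,
    (∀ α ∈ D.roots, D.IsHalfSpace α (H α) ∨ D.IsOpenHalfSpace α (H α)) ∧
    E = ⋂ α ∈ D.roots, H α

variable {D} in
theorem halfSpace_total {α : Dual ℝ V} {H H' : Set 𝔸}
    (h : D.IsHalfSpace α H ∨ D.IsOpenHalfSpace α H)
    (h' : D.IsHalfSpace α H' ∨ D.IsOpenHalfSpace α H') : H ⊆ H' ∨ H' ⊆ H := by
  have key : ∀ p q a : 𝔸, α (a -ᵥ p) = α (a -ᵥ q) + α (q -ᵥ p) := fun p q a => by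
    rw [← map_add, vsub_add_vsub_cancel]
  rcases h with (rfl | ⟨p, -, rfl⟩) | (rfl | ⟨p, -, rfl⟩)
  · exact Or.inr (subset_univ _)
  all_goals try exact Or.inr (subset_univ _)
  all_goals
    rcases h' with (rfl | ⟨q, -, rfl⟩) | (rfl | ⟨q, -, rfl⟩)
    all_goals try exact Or.inl (subset_univ _)
    all_goals
      by_contra! hc
      obtain ⟨⟨a, ha, ha'⟩, b, hb, hb'⟩ := (And.imp not_subset.1 not_subset.1 hc)
      have h1 := key p q a
      have h2 := key p q b
      simp only [mem_ofPred_eq, not_le, not_lt] at ha ha' hb hb'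
      linarith

variable {D} in
theorem IsClosedCell.inter {E E' : Set 𝔸} (h : D.IsClosedCell E) (h' : D.IsClosedCell E') :
    D.IsClosedCell (E ∩ E') := by
  obtain ⟨H, hH, rfl⟩ := h
  obtain ⟨H', hH', rfl⟩ := h'
  refine ⟨fun α => H α ∩ H' α, fun α hα => ?_, ?_⟩
  · rcases halfSpace_total (Or.inl (hH α hα)) (Or.inl (hH' α hα)) with h | h
    · simpa only [inter_eq_left.2 h] using hH α hα
    · simpa only [inter_eq_right.2 h] using hH' α hα
  · simp only [iInter_inter_distrib]

variable {D} in
theorem IsCell.inter {E E' : Set 𝔸} (h : D.IsCell E) (h' : D.IsCell E') :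
    D.IsCell (E ∩ E') := by
  obtain ⟨H, hH, rfl⟩ := h
  obtain ⟨H', hH', rfl⟩ := h'
  refine ⟨fun α => H α ∩ H' α, fun α hα => ?_, ?_⟩
  · rcases halfSpace_total (hH α hα) (hH' α hα) with h | h
    · simpa only [inter_eq_left.2 h] using hH α hα
    · simpa only [inter_eq_right.2 h] using hH' α hα
  · simp only [iInter_inter_distrib]

theorem isClosedCell_univ : D.IsClosedCell univ :=
  ⟨fun _ => univ, fun _ _ => Or.inl rfl, by simp⟩

theorem isCell_univ : D.IsCell univ :=
  ⟨fun _ => univ, fun _ _ => Or.inl (Or.inl rfl), by simp⟩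

/-- The enclosure `cl(F)` of a filter `F`: the sets that contain an element of `F` of the form
`⋂ α, D(α, k_α)`. A filter `F` is contained in a filter `G` when `F ≤ G`, and a set is identified
with the principal filter that it generates. -/
def enclosure (F : Filter 𝔸) : Filter 𝔸 where
  sets := {S | ∃ E ∈ F, D.IsClosedCell E ∧ E ⊆ S}
  univ_sets := ⟨univ, univ_mem, D.isClosedCell_univ, Subset.rfl⟩
  sets_of_superset := fun ⟨E, hE, hc, hs⟩ h => ⟨E, hE, hc, hs.trans h⟩
  inter_sets := fun ⟨E, hE, hc, hs⟩ ⟨E', hE', hc', hs'⟩ =>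
    ⟨E ∩ E', inter_mem hE hE', hc.inter hc', inter_subset_inter hs hs'⟩

/-- The facet `F(x, Fᵛ)`: the sets that contain an intersection of closed or open half-spaces,
one for each root, that contains the local facet `germ_x (x + Fᵛ)`. -/
def facet (x : 𝔸) (Fv : Set V) : Filter 𝔸 where
  sets := {S | ∃ E ∈ 𝓝[(fun v => v +ᵥ x) '' Fv] x, D.IsCell E ∧ E ⊆ S}
  univ_sets := ⟨univ, univ_mem, D.isCell_univ, Subset.rfl⟩
  sets_of_superset := fun ⟨E, hE, hc, hs⟩ h => ⟨E, hE, hc, hs.trans h⟩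
  inter_sets := fun ⟨E, hE, hc, hs⟩ ⟨E', hE', hc', hs'⟩ =>
    ⟨E ∩ E', inter_mem hE hE', hc.inter hc', inter_subset_inter hs hs'⟩

/-- The chimney `cl(F + Fᵛ)` with base `F` and direction `Fᵛ`. -/
def chimney (F : Filter 𝔸) (Fv : Set V) : Filter 𝔸 :=
  D.enclosure (Filter.map₂ (fun v a => v +ᵥ a) (𝓟 Fv) F)

/-- The germ of a chimney: the sets that contain one of its shortenings `cl(F + ξ + Fᵛ)`, for
`ξ` in the closure of `Fᵛ` (these shortenings form a directed family). -/
def chimneyGerm (F : Filter 𝔸) (Fv : Set V) : Filter 𝔸 :=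
  ⨅ ξ ∈ closure Fv, D.chimney (Filter.map (fun a => ξ +ᵥ a) F) Fv

/-- The support of a filter: the smallest affine subspace that contains it. -/
def support (F : Filter 𝔸) : AffineSubspace ℝ 𝔸 :=
  sInf {E : AffineSubspace ℝ 𝔸 | (E : Set 𝔸) ∈ F}

/-- A filter is solid if the direction of its support has a finite pointwise fixer in `Wᵛ`. -/
def IsSolid (F : Filter 𝔸) : Prop :=
  {w | w ∈ D.vectorialWeyl ∧ ∀ v ∈ (support F).direction, w v = v}.Finite

/-- The facets of `𝔸`. -/
def IsFacet (F : Filter 𝔸) : Prop :=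
  ∃ x Fv, D.IsVectorialFacet Fv ∧ F = D.facet x Fv

/-- The solid chimneys of `𝔸`. -/
def IsSolidChimney (F : Filter 𝔸) : Prop :=
  ∃ B Fv, D.IsFacet B ∧ D.IsVectorialFacet Fv ∧ D.IsSolid (D.chimney B Fv) ∧ F = D.chimney B Fv

/-- The germs of solid chimneys of `𝔸`. -/
def IsSolidChimneyGerm (F : Filter 𝔸) : Prop :=
  ∃ B Fv, D.IsFacet B ∧ D.IsVectorialFacet Fv ∧ D.IsSolid (D.chimney B Fv) ∧
    F = D.chimneyGerm B Fv

/-- The germs of splayed chimneys of `𝔸`: those with a spherical direction. -/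
def IsSplayedChimneyGerm (F : Filter 𝔸) : Prop :=
  ∃ B Fv, D.IsFacet B ∧ D.IsSphericalFacet Fv ∧ F = D.chimneyGerm B Fv

/-- The preorder `p ≤ q` on `𝔸`. -/
def Le (p q : 𝔸) : Prop := q -ᵥ p ∈ D.titsCone

/-- The preorder `p ≤° q` on `𝔸`. -/
def OpenLe (p q : 𝔸) : Prop := q -ᵥ p ∈ interior D.titsCone ∪ {0}

/-- The germs at `p` of preordered intervals `]p, q]`. -/
def IsPreorderedIntervalGerm (F : Filter 𝔸) : Prop :=
  ∃ p q, p ≠ q ∧ (D.Le p q ∨ D.Le q p) ∧ F = 𝓝[affineSegment ℝ p q \ {p}] p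

/-- The generic half-lines, with origin `p` and containing `q`. -/
def IsGenericRay (F : Filter 𝔸) : Prop :=
  ∃ p q, p ≠ q ∧ (D.OpenLe p q ∨ D.OpenLe q p) ∧
    F = 𝓟 {a | ∃ t : ℝ, 0 ≤ t ∧ a = t • (q -ᵥ p) +ᵥ p}

end ModelApartment

/-- A set covered by subsets called apartments, each with a structure of apartment of type `𝔸`:
a nonempty set of bijections from `𝔸`, which is an orbit under composition with `W`. -/
structure ApartmentSystem {V 𝔸 I : Type*} [NormedAddCommGroup V] [NormedSpace ℝ V]
    [MetricSpace 𝔸] [NormedAddTorsor V 𝔸] [Fintype I] (D : ModelApartment V 𝔸 I)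
    (X : Type*) where
  apartments : Set (Set X)
  cover : ∀ z, ∃ A ∈ apartments, z ∈ A
  /-- the isomorphisms from `𝔸` to an apartment -/
  isom : (A : Set X) → Set (𝔸 ≃ A)
  isom_nonempty : ∀ A ∈ apartments, (isom A).Nonempty
  mem_isom_iff : ∀ A ∈ apartments, ∀ f₀ ∈ isom A, ∀ f : 𝔸 ≃ A,
    f ∈ isom A ↔ ∃ w ∈ D.weyl, f = w.toEquiv.trans f₀

namespace ApartmentSystem

variable {V 𝔸 I X : Type*} [NormedAddCommGroup V] [NormedSpace ℝ V]
  [MetricSpace 𝔸] [NormedAddTorsor V 𝔸] [Fintype I] {D : ModelApartment V 𝔸 I}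
  (H : ApartmentSystem D X)

/-- The isomorphisms between two apartments. -/
def IsIso (A A' : Set X) (φ : A ≃ A') : Prop :=
  ∃ f ∈ H.isom A, f.trans φ ∈ H.isom A'

/-- The map `φ` fixes the filter `G`, i.e. it fixes pointwise an element of `G`. -/
def Fixes {A A' : Set X} (φ : A ≃ A') (G : Filter X) : Prop :=
  {z | ∃ h : z ∈ A, (φ ⟨z, h⟩ : X) = z} ∈ G

/-- The filter `G` on `X` is, in the apartment `A`, an object of the kind `P`. -/
def IsIn (P : Filter 𝔸 → Prop) (A : Set X) (G : Filter X) : Prop :=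
  ∃ f ∈ H.isom A, ∃ F, P F ∧ G = Filter.map (fun p => (f p : X)) F

/-- The enclosure `cl_A(G)`, computed in an isomorphism `𝔸 → A`. The result is the same for all
these isomorphisms, since they differ by elements of `W`. -/
def enclosure (A : Set X) (G : Filter X) : Filter X :=
  ⨆ f ∈ H.isom A, Filter.map (fun p => (f p : X))
    (D.enclosure (Filter.comap (fun p => (f p : X)) G))

/-- The relation `x ≤_A y`. -/
def LeIn (A : Set X) (x y : X) : Prop :=
  ∃ f ∈ H.isom A, ∃ p q, (f p : X) = x ∧ (f q : X) = y ∧ D.Le p q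

/-- The relation `x ≤°_A y`. -/
def OpenLeIn (A : Set X) (x y : X) : Prop :=
  ∃ f ∈ H.isom A, ∃ p q, (f p : X) = x ∧ (f q : X) = y ∧ D.OpenLe p q

/-- The segment `[x, y]_A`. -/
def segmentIn (A : Set X) (x y : X) : Set X :=
  {z | ∃ f ∈ H.isom A, ∃ p q, (f p : X) = x ∧ (f q : X) = y ∧
    ∃ m ∈ affineSegment ℝ p q, (f m : X) = z}

/-- The relation `x ≤ y` on `X`: it holds in some apartment. -/
def Le (x y : X) : Prop := ∃ A ∈ H.apartments, H.LeIn A x y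

/-- The relation `x ≤° y` on `X`: it holds in some apartment. -/
def OpenLe (x y : X) : Prop := ∃ A ∈ H.apartments, H.OpenLeIn A x y

/-- The axioms of affine hovels (besides the apartment structures). A filter on `X` is contained
in `A` when `A` belongs to it. -/
structure IsAffineHovel : Prop where
  MA2 : ∀ A ∈ H.apartments, ∀ G : Filter X,
    ((∃ x ∈ A, G = 𝓟 {x}) ∨ H.IsIn D.IsPreorderedIntervalGerm A G ∨
      H.IsIn D.IsGenericRay A G ∨ H.IsIn D.IsSolidChimney A G) →
    ∀ A' ∈ H.apartments, A' ∈ G →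
      A ∩ A' ∈ H.enclosure A G ∧ ∃ φ : A ≃ A', H.IsIso A A' φ ∧ Fixes φ (H.enclosure A G)
  MA3 : ∀ B ∈ H.apartments, ∀ B' ∈ H.apartments, ∀ R F : Filter X,
    H.IsIn D.IsSplayedChimneyGerm B R →
    (H.IsIn D.IsFacet B' F ∨ H.IsIn D.IsSolidChimneyGerm B' F) →
    ∃ A ∈ H.apartments, A ∈ R ∧ A ∈ F
  MA4 : ∀ B ∈ H.apartments, ∀ B' ∈ H.apartments, ∀ R F : Filter X,
    H.IsIn D.IsSplayedChimneyGerm B R →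
    (H.IsIn D.IsFacet B' F ∨ H.IsIn D.IsSolidChimneyGerm B' F) →
    ∀ A ∈ H.apartments, ∀ A' ∈ H.apartments, A ∈ R → A ∈ F → A' ∈ R → A' ∈ F →
      A ∩ A' ∈ H.enclosure A (R ⊔ F) ∧
      ∃ φ : A ≃ A', H.IsIso A A' φ ∧ Fixes φ (H.enclosure A (R ⊔ F))

/-- The axiom (MAO) of ordered hovels. -/
def IsOrdered : Prop :=
  ∀ x y, ∀ A ∈ H.apartments, ∀ A' ∈ H.apartments, x ∈ A → y ∈ A → x ∈ A' → y ∈ A' →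
    H.LeIn A x y → H.segmentIn A x y = H.segmentIn A' x y

end ApartmentSystem

end Hovel

end

/-!
The Weyl group reduces the statement to the case where `x - y` lies in the closed chamber of a
vector `e` that is regular and dominant or antidominant. By (MAO), charts of the two apartments can
be chosen to agree at `x` and at `y`, and a third apartment, given by (MA3), separates the
comparison in two: charts that agree on the germ at infinity of the sectors of direction `-e` and
at `x`, for which (MA4) is enough, and charts `f` and `h` that agree at `y` and on the germ at `x`
of the ray `x + ℝ₊ e`.

In the second case it suffices to find a chart `g` that agrees with `f` near `x` and on the sector
germ of direction `-e`, and with `h` far away on the ray, and whose apartment contains the sector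
germ of direction `e` of `h`: then (MA4), applied to each of these opposite sector germs and one
point, identifies `f` with `g` and `g` with `h` on the enclosure of `{x, y}`. The apartment of `g`
is reached along the ray: the set of the `t ≥ 0` such that some chart joins `f` on the sector germ
of direction `-e` to `h` on the germ of the ray at `x + te` is open to the right, because the
enclosure of a ray germ is a neighbourhood of the nearby points of the ray, and it contains the
limits from the left of its points, by (MA3) and (MA4) at the limit point.
-/

namespace Hovel

namespace SimpleRoots

variable {V I : Type*} [AddCommGroup V] [Module ℝ V] (R : SimpleRoots V I)

/-- The vectors of the open fundamental chamber `C` and of `-C`. A regular vector `e` stands for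
the one of these two chambers that contains it, so that `e` and `-e` stand for opposite chambers.
The condition `e ≠ 0` only matters when there is no root at all. -/
def IsRegular (e : V) : Prop := e ≠ 0 ∧ ((∀ i, 0 < R.root i e) ∨ ∀ i, R.root i e < 0)

/-- The open chamber, `C` or `-C`, that contains the regular vector `e`. -/
def chamber (e : V) : Set V := {v | ∀ i, 0 < R.root i e * R.root i v}

/-- The closure of the chamber that contains the regular vector `e`. -/
def closedChamber (e : V) : Set V := {v | ∀ i, 0 ≤ R.root i e * R.root i v}

/-- The vectors `v` for which `p` and `p + v` are comparable for the preorder `≤`. -/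
def IsComparable (v : V) : Prop := v ∈ R.titsCone ∨ -v ∈ R.titsCone

variable {R} {e v v' : V}

theorem neg_mem_closedChamber : -v ∈ R.closedChamber e ↔ v ∈ R.closedChamber (-e) := by
  simp [closedChamber]

theorem add_mem_closedChamber (hv : v ∈ R.closedChamber e) (hv' : v' ∈ R.closedChamber e) :
    v + v' ∈ R.closedChamber e := fun i => by
  rw [map_add, mul_add]
  exact add_nonneg (hv i) (hv' i)

theorem smul_mem_closedChamber {t : ℝ} (ht : 0 ≤ t) (hv : v ∈ R.closedChamber e) :
    t • v ∈ R.closedChamber e := fun i => by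
  rw [map_smul, smul_eq_mul, mul_left_comm]
  exact mul_nonneg ht (hv i)

theorem self_mem_closedChamber : e ∈ R.closedChamber e := fun _ => mul_self_nonneg _

theorem chamber_subset_closedChamber : R.chamber e ⊆ R.closedChamber e := fun _ hv i => (hv i).le

theorem mem_titsCone_of_nonneg (hv : ∀ i, 0 ≤ R.root i v) : v ∈ R.titsCone :=
  ⟨1, one_mem _, {i | R.root i v = 0}, v,
    ⟨fun _ hi => hi, fun i hi => lt_of_le_of_ne (hv i) (Ne.symm hi)⟩, rfl⟩

theorem zero_mem_titsCone : (0 : V) ∈ R.titsCone := mem_titsCone_of_nonneg fun i => by simp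

theorem exists_dominant_of_mem_titsCone (hv : v ∈ R.titsCone) :
    ∃ w ∈ R.vectorialWeyl, ∃ u, (∀ i, 0 ≤ R.root i u) ∧ w u = v := by
  obtain ⟨w, hw, J, u, hu, rfl⟩ := hv
  refine ⟨w, hw, u, fun i => ?_, rfl⟩
  by_cases hi : i ∈ J
  · exact (hu.1 i hi).ge
  · exact (hu.2 i hi).le

theorem apply_mem_titsCone {w : V ≃ₗ[ℝ] V} (hw : w ∈ R.vectorialWeyl) (hv : v ∈ R.titsCone) :
    w v ∈ R.titsCone := by
  obtain ⟨w', hw', J, u, hu, rfl⟩ := hv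
  exact ⟨w * w', mul_mem hw hw', J, u, hu, rfl⟩

theorem smul_mem_titsCone {c : ℝ} (hc : 0 ≤ c) (hv : v ∈ R.titsCone) : c • v ∈ R.titsCone := by
  obtain ⟨w, hw, u, hu, rfl⟩ := exists_dominant_of_mem_titsCone hv
  rw [← map_smul]
  exact apply_mem_titsCone hw (mem_titsCone_of_nonneg fun i => by simpa using mul_nonneg hc (hu i))

theorem IsComparable.neg (hv : R.IsComparable v) : R.IsComparable (-v) := by
  rw [IsComparable, neg_neg]
  exact hv.symm

theorem IsComparable.smul {c : ℝ} (hc : 0 ≤ c) (hv : R.IsComparable v) :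
    R.IsComparable (c • v) := by
  rw [IsComparable, ← smul_neg]
  exact hv.imp (smul_mem_titsCone hc) (smul_mem_titsCone hc)

namespace IsRegular

theorem neg (he : R.IsRegular e) : R.IsRegular (-e) :=
  ⟨neg_ne_zero.2 he.1, he.2.symm.imp (fun h i => by simpa using h i) fun h i => by simpa using h i⟩

theorem root_ne_zero (he : R.IsRegular e) (i : I) : R.root i e ≠ 0 :=
  he.2.elim (fun h => (h i).ne') fun h => (h i).ne

theorem self_mem_chamber (he : R.IsRegular e) : e ∈ R.chamber e := fun i =>
  mul_self_pos.2 (he.root_ne_zero i)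

theorem smul_mem_chamber (he : R.IsRegular e) {t : ℝ} (ht : 0 < t) : t • e ∈ R.chamber e :=
  fun i => by
    rw [map_smul, smul_eq_mul, mul_left_comm]
    exact mul_pos ht (he.self_mem_chamber i)

theorem closedChamber_nonneg_or_nonpos (he : R.IsRegular e) :
    (∀ v ∈ R.closedChamber e, ∀ i, 0 ≤ R.root i v) ∨
      ∀ v ∈ R.closedChamber e, ∀ i, R.root i v ≤ 0 :=
  he.2.imp (fun h _ hv i => nonneg_of_mul_nonneg_right (hv i) (h i))
    fun h _ hv i => nonpos_of_mul_nonneg_right (hv i) (h i)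

theorem isComparable (he : R.IsRegular e) (hv : v ∈ R.closedChamber e) : R.IsComparable v :=
  he.closedChamber_nonneg_or_nonpos.imp (fun h => mem_titsCone_of_nonneg (h v hv))
    fun h => mem_titsCone_of_nonneg fun i => by simpa using h v hv i

theorem eventually_add_smul_mem_chamber [Finite I] (he : R.IsRegular e) (v : V) :
    ∀ᶠ t : ℝ in atTop, v + t • e ∈ R.chamber e := by
  refine eventually_all.2 fun i => ?_
  have hpos := he.self_mem_chamber i
  have h : Tendsto (fun t : ℝ => R.root i e * R.root i v + t * (R.root i e * R.root i e)) atTop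
      atTop := tendsto_atTop_add_const_left _ _ (tendsto_id.atTop_mul_const hpos)
  filter_upwards [h.eventually_gt_atTop 0] with t ht
  rw [map_add, map_smul, smul_eq_mul]
  linear_combination ht

theorem isSphericalFacet_chamber (he : R.IsRegular e) : R.IsSphericalFacet (R.chamber e) := by
  refine ⟨1, one_mem _, ∅, ?_, he.2.imp (fun h => ?_) fun h => ?_⟩
  · rw [parabolic, image_empty, Subgroup.closure_empty]
    infer_instance
  · ext v
    simp [chamber, stdFacet, h]
  · ext v
    rw [← image_image (fun v => -v), LinearEquiv.coe_one, image_id, image_neg_eq_neg]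
    simp [chamber, stdFacet, mul_pos_iff, h, (h _).not_gt]

theorem isVectorialFacet_chamber (he : R.IsRegular e) : R.IsVectorialFacet (R.chamber e) := by
  obtain ⟨w, hw, J, -, h⟩ := he.isSphericalFacet_chamber
  exact ⟨w, hw, J, h⟩

end IsRegular

theorem isVectorialFacet_stdFacet (J : Set I) : R.IsVectorialFacet (R.stdFacet J) :=
  ⟨1, one_mem _, J, Or.inl (image_id _).symm⟩

theorem exists_ne_zero_root_pos [FiniteDimensional ℝ V] [Nontrivial V] (R : SimpleRoots V I) :
    ∃ e : V, e ≠ 0 ∧ ∀ i, 0 < R.root i e := by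
  rcases isEmpty_or_nonempty I with hI | ⟨⟨i₀⟩⟩
  · obtain ⟨e, he⟩ := exists_ne (0 : V)
    exact ⟨e, he, isEmptyElim⟩
  obtain ⟨φ, hφ⟩ := exists_dual_forall_apply_eq_one
    (linearIndepOn_univ_iff.2 R.root_independent)
  have hroot : ∀ i, R.root i ((evalEquiv ℝ V).symm φ) = 1 := fun i => by
    rw [apply_evalEquiv_symm_apply, hφ i (mem_univ i)]
  refine ⟨(evalEquiv ℝ V).symm φ, fun h => ?_, fun i => (hroot i).symm ▸ one_pos⟩
  simpa [h] using hroot i₀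

theorem comp_mem_realRoots {w : V ≃ₗ[ℝ] V} (hw : w ∈ R.vectorialWeyl) {α : Dual ℝ V}
    (hα : α ∈ R.realRoots) : α ∘ₗ (w : V →ₗ[ℝ] V) ∈ R.realRoots := by
  obtain ⟨w', hw', i, rfl⟩ := hα
  exact ⟨w⁻¹ * w', mul_mem (inv_mem hw) hw', i, rfl⟩

theorem nonneg_of_mem_positiveCone [Fintype I] {β : Dual ℝ V} (hβ : β ∈ R.positiveCone)
    (hv : ∀ i, 0 ≤ R.root i v) : 0 ≤ β v := by
  obtain ⟨c, hc, rfl⟩ := hβ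
  simp only [LinearMap.sum_apply, LinearMap.smul_apply, smul_eq_mul]
  exact Finset.sum_nonneg fun i _ => mul_nonneg (hc i) (hv i)

theorem isOpen_chamber {V : Type*} [NormedAddCommGroup V] [NormedSpace ℝ V]
    [FiniteDimensional ℝ V] [Finite I] (R : SimpleRoots V I) (e : V) : IsOpen (R.chamber e) := by
  simp only [chamber, ofPred_forall]
  exact isOpen_iInter_of_finite fun i => isOpen_lt continuous_const
    (continuous_const.mul (LinearMap.continuous_of_finiteDimensional (R.root i)))

end SimpleRoots

namespace VectorialDatum

variable {V I : Type*} [AddCommGroup V] [Module ℝ V] [Fintype I] {D : VectorialDatum V I}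

theorem ModeratelyImaginary.nonneg_or_nonpos (hD : D.ModeratelyImaginary) {e : V}
    (he : D.IsRegular e) {α : Dual ℝ V} (hα : α ∈ D.roots) :
    (∀ v ∈ D.closedChamber e, 0 ≤ α v) ∨ ∀ v ∈ D.closedChamber e, α v ≤ 0 := by
  have hsign : α ∈ D.positiveCone ∨ -α ∈ D.positiveCone := hα.elim (D.pos_or_neg α) (hD.1 α)
  rcases he.closedChamber_nonneg_or_nonpos with he | he
  · refine hsign.imp (fun h v hv => SimpleRoots.nonneg_of_mem_positiveCone h (he v hv))
      fun h v hv => ?_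
    simpa using SimpleRoots.nonneg_of_mem_positiveCone h (he v hv)
  · have hneg : ∀ v ∈ D.closedChamber e, ∀ i, 0 ≤ D.root i (-v) := fun v hv i => by
      simpa using he v hv i
    refine hsign.symm.imp (fun h v hv => ?_) fun h v hv => ?_
    · simpa using SimpleRoots.nonneg_of_mem_positiveCone h (hneg v hv)
    · simpa using SimpleRoots.nonneg_of_mem_positiveCone h (hneg v hv)

theorem comp_mem_imRoots {w : V ≃ₗ[ℝ] V} (hw : w ∈ D.vectorialWeyl) {α : Dual ℝ V}
    (hα : α ∈ D.imRoots) : α ∘ₗ (w : V →ₗ[ℝ] V) ∈ D.imRoots :=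
  D.imRoots_weyl w⁻¹ (inv_mem hw) α hα

theorem comp_mem_roots {w : V ≃ₗ[ℝ] V} (hw : w ∈ D.vectorialWeyl) {α : Dual ℝ V}
    (hα : α ∈ D.roots) : α ∘ₗ (w : V →ₗ[ℝ] V) ∈ D.roots :=
  hα.imp (SimpleRoots.comp_mem_realRoots hw) (comp_mem_imRoots hw)

theorem root_nonpos_of_isRightDescent {w : D.vectorialWeyl} {i : I}
    (hi : D.coxeterSystem.IsRightDescent w i) {v : V}
    (hwv : ∀ j, 0 ≤ D.root j ((w : V ≃ₗ[ℝ] V) v)) : D.root i v ≤ 0 := by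
  rw [CoxeterSystem.IsRightDescent, D.coxeter_simple] at hi
  have hneg := (D.pos_or_neg _ ⟨w, w.2, i, rfl⟩).resolve_left
    fun h => hi.not_gt ((D.pos_iff_length w i).1 h)
  simpa using SimpleRoots.nonneg_of_mem_positiveCone hneg hwv

theorem apply_eq_self_of_dominant {v : V} (hv : ∀ i, 0 ≤ D.root i v) {w : D.vectorialWeyl}
    (hwv : ∀ i, 0 ≤ D.root i ((w : V ≃ₗ[ℝ] V) v)) : (w : V ≃ₗ[ℝ] V) v = v := by
  induction h : D.coxeterSystem.length w using Nat.strong_induction_on generalizing w with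
  | _ n ih =>
    subst h
    rcases eq_or_ne w 1 with rfl | hw
    · rfl
    obtain ⟨i, hi⟩ := D.coxeterSystem.exists_rightDescent_of_ne_one hw
    have hroot : D.root i v = 0 := le_antisymm (root_nonpos_of_isRightDescent hi hwv) (hv i)
    have hfix : D.simpleReflection i v = v := by
      rw [SimpleRoots.simpleReflection, Module.reflection_apply, hroot, zero_smul, sub_zero]
    have happ : ((w * D.simpleReflectionW i : D.vectorialWeyl) : V ≃ₗ[ℝ] V) v =
        (w : V ≃ₗ[ℝ] V) v := congrArg (w : V ≃ₗ[ℝ] V) hfix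
    rw [CoxeterSystem.IsRightDescent, D.coxeter_simple] at hi
    rw [← happ] at hwv ⊢
    exact ih _ hi hwv rfl

theorem eq_one_of_apply_eq_smul {v : V} (hv : D.IsComparable v) (hv0 : v ≠ 0)
    {w : V ≃ₗ[ℝ] V} (hw : w ∈ D.vectorialWeyl) {c : ℝ} (hc : 0 ≤ c) (h : w v = c • v) :
    c = 1 := by
  wlog hpos : v ∈ D.titsCone generalizing v
  · exact this hv.neg (neg_ne_zero.2 hv0) (by rw [map_neg, h, smul_neg])
      (hv.resolve_left hpos)
  obtain ⟨w', hw', u, hu, rfl⟩ := SimpleRoots.exists_dominant_of_mem_titsCone hpos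
  have hconj : (w'⁻¹ * w * w') u = c • u := by
    change w'.symm (w (w' u)) = c • u
    rw [h, map_smul, LinearEquiv.symm_apply_apply]
  have hfix : (w'⁻¹ * w * w') u = u := apply_eq_self_of_dominant hu
    (w := ⟨_, mul_mem (mul_mem (inv_mem hw') hw) hw'⟩) fun i => by
      simpa [hconj] using mul_nonneg hc (hu i)
  have hu0 : u ≠ 0 := fun h => hv0 (by rw [h, map_zero])
  exact smul_left_injective ℝ hu0 (by simpa [one_smul] using hconj.symm.trans hfix)

theorem eq_one_of_apply_eq_of_isRegular {e : V} (he : D.IsRegular e) {w : V ≃ₗ[ℝ] V}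
    (hw : w ∈ D.vectorialWeyl) (h : w e = e) : w = 1 := by
  wlog hpos : ∀ i, 0 < D.root i e generalizing e
  · exact this he.neg (by rw [map_neg, h]) fun i => by
      simpa using he.2.resolve_left hpos i
  by_contra hne
  obtain ⟨i, hi⟩ := D.coxeterSystem.exists_rightDescent_of_ne_one
    (w := ⟨w, hw⟩) fun h => hne (congrArg Subtype.val h)
  exact (root_nonpos_of_isRightDescent hi fun j => (hpos j).le.trans_eq (by rw [h])).not_gt
    (hpos i)

end VectorialDatum

namespace ModelApartment

section RayGerm

variable {V 𝔸 : Type*} [NormedAddCommGroup V] [NormedSpace ℝ V] [MetricSpace 𝔸]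
  [NormedAddTorsor V 𝔸] {p : 𝔸} {v : V}

/-- The germ at `p` of the open half-line with origin `p` and direction `v`. -/
def rayGerm (p : 𝔸) (v : V) : Filter 𝔸 := map (fun t : ℝ => t • v +ᵥ p) (𝓝[>] 0)

theorem rayGerm_le_nhds : rayGerm p v ≤ 𝓝 p := by
  have h : Continuous fun t : ℝ => t • v +ᵥ p := by fun_prop
  exact (h.tendsto' 0 p (by rw [zero_smul, zero_vadd])).mono_left nhdsWithin_le_nhds

theorem nhdsWithin_affineSegment_diff (hv : v ≠ 0) :
    𝓝[affineSegment ℝ p (v +ᵥ p) \ {p}] p = rayGerm p v := by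
  have hemb : IsEmbedding fun t : ℝ => t • v +ᵥ p :=
    (Homeomorph.vaddConst p).isEmbedding.comp (isClosedEmbedding_smul_left hv).isEmbedding
  have himage : (fun t : ℝ => t • v +ᵥ p) '' Ioc 0 1 = affineSegment ℝ p (v +ᵥ p) \ {p} := by
    rw [← Icc_sdiff_left, image_sdiff hemb.injective, affineSegment, image_singleton, zero_smul,
      zero_vadd]
    congr 2 with t
    rw [AffineMap.lineMap_apply, vadd_vsub]
  rw [← himage, rayGerm, ← nhdsWithin_Ioc_eq_nhdsGT zero_lt_one, hemb.map_nhdsWithin_eq,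
    zero_smul, zero_vadd]

theorem rayGerm_smul_vadd (t : ℝ) :
    rayGerm (t • v +ᵥ p) v = map (fun s : ℝ => s • v +ᵥ p) (𝓝[>] t) := by
  rw [rayGerm, ← zero_add t, ← map_add_right_nhdsGT, map_map, zero_add]
  congr 1 with s
  rw [Function.comp_apply, vadd_vadd, add_smul]

theorem rayGerm_smul_vadd_neg (t : ℝ) :
    rayGerm (t • v +ᵥ p) (-v) = map (fun s : ℝ => s • v +ᵥ p) (𝓝[<] t) := by
  rw [rayGerm, ← sub_zero t, ← map_subLeft_nhdsGT, map_map, sub_zero]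
  congr 1 with s
  rw [Function.comp_apply, vadd_vadd, sub_smul, smul_neg, neg_add_eq_sub]

end RayGerm

variable {V 𝔸 I : Type*} [NormedAddCommGroup V] [NormedSpace ℝ V] [MetricSpace 𝔸]
  [NormedAddTorsor V 𝔸] [Fintype I] {D : ModelApartment V 𝔸 I}

theorem OpenLe.le {p q : 𝔸} (h : D.OpenLe p q) : D.Le p q :=
  h.elim (fun h => interior_subset h) fun h => by
    rw [ModelApartment.Le, h]
    exact SimpleRoots.zero_mem_titsCone

theorem linear_mem_vectorialWeyl {w : 𝔸 ≃ᵃ[ℝ] 𝔸} (hw : w ∈ D.weyl) :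
    w.linear ∈ D.vectorialWeyl := by
  suffices D.weyl ≤ D.vectorialWeyl.comap AffineEquiv.linearHom from this hw
  refine (Subgroup.closure_le _).2 ?_
  rintro g ⟨M, -, w, hw, i, -, hg, -⟩
  change g.linear ∈ D.vectorialWeyl
  rw [hg]
  exact mul_mem (mul_mem hw (D.simpleReflectionW i).2) (inv_mem hw)

theorem exists_mem_wallReflections_linear_eq (i : I) :
    ∃ g ∈ wallReflections D.toSimpleRoots D.walls, g.linear = D.simpleReflection i := by
  obtain ⟨M, hM, hdir⟩ := (D.infinite_walls (D.root i) ⟨1, one_mem _, i, rfl⟩).nonempty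
  obtain ⟨p, hp⟩ := D.wall_nonempty M hM
  let g : 𝔸 ≃ᵃ[ℝ] 𝔸 := AffineEquiv.mk' (fun q => D.simpleReflection i (q -ᵥ p) +ᵥ p)
    (D.simpleReflection i) p (fun q => by simp)
  refine ⟨g, ⟨M, hM, 1, one_mem _, i, hdir, ?_, fun q hq => ?_⟩, rfl⟩
  · rw [one_mul, inv_one, mul_one]
    rfl
  have hroot : D.root i (q -ᵥ p) = 0 := by
    rw [← LinearMap.mem_ker, ← hdir]
    exact AffineSubspace.vsub_mem_direction hq hp
  change D.simpleReflection i (q -ᵥ p) +ᵥ p = q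
  rw [SimpleRoots.simpleReflection, Module.reflection_apply, hroot, zero_smul, sub_zero, vsub_vadd]

theorem exists_mem_weyl_linear_eq {w : V ≃ₗ[ℝ] V} (hw : w ∈ D.vectorialWeyl) :
    ∃ g ∈ D.weyl, g.linear = w := by
  suffices D.vectorialWeyl ≤ D.weyl.map AffineEquiv.linearHom from this hw
  refine (Subgroup.closure_le _).2 ?_
  rintro _ ⟨i, rfl⟩
  obtain ⟨g, hg, hlin⟩ := exists_mem_wallReflections_linear_eq (D := D) i
  exact ⟨g, Subgroup.subset_closure hg, hlin⟩

theorem IsWallAt.comp_linear {α : Dual ℝ V} {p : 𝔸} (h : D.IsWallAt α p) {w : 𝔸 ≃ᵃ[ℝ] 𝔸}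
    (hw : w ∈ D.weyl) : D.IsWallAt (α ∘ₗ (w.linear : V →ₗ[ℝ] V)) (w.symm p) := by
  have hlin := linear_mem_vectorialWeyl hw
  refine h.imp (fun h => ⟨SimpleRoots.comp_mem_realRoots hlin h.1, ?_⟩)
    (VectorialDatum.comp_mem_imRoots hlin)
  have hmap := D.walls_stable w⁻¹ (inv_mem hw) _ h.2
  rw [AffineSubspace.map_mk'] at hmap
  have hker : (LinearMap.ker α).map (w.linear.symm : V →ₗ[ℝ] V) =
      LinearMap.ker (α ∘ₗ (w.linear : V →ₗ[ℝ] V)) := by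
    rw [LinearMap.ker_comp]
    exact Submodule.map_equiv_eq_comap_symm w.linear.symm _
  exact hker ▸ hmap

theorem IsHalfSpace.preimage {α : Dual ℝ V} {E : Set 𝔸} (h : D.IsHalfSpace α E)
    {w : 𝔸 ≃ᵃ[ℝ] 𝔸} (hw : w ∈ D.weyl) :
    D.IsHalfSpace (α ∘ₗ (w.linear : V →ₗ[ℝ] V)) (w ⁻¹' E) := by
  rcases h with rfl | ⟨p, hp, rfl⟩
  · exact Or.inl preimage_univ
  · refine Or.inr ⟨w.symm p, hp.comp_linear hw, ?_⟩
    ext a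
    have hlin : w.linear (a -ᵥ w.symm p) = w a -ᵥ p := by
      simpa using w.toAffineMap.linearMap_vsub a (w.symm p)
    simp [hlin]

theorem IsClosedCell.preimage {E : Set 𝔸} (hE : D.IsClosedCell E) {w : 𝔸 ≃ᵃ[ℝ] 𝔸}
    (hw : w ∈ D.weyl) : D.IsClosedCell (w ⁻¹' E) := by
  obtain ⟨H, hH, rfl⟩ := hE
  have hlin := linear_mem_vectorialWeyl hw
  have hroot : ∀ {β}, β ∈ D.roots → β ∘ₗ (w.linear.symm : V →ₗ[ℝ] V) ∈ D.roots :=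
    VectorialDatum.comp_mem_roots (inv_mem hlin)
  refine ⟨fun β => w ⁻¹' H (β ∘ₗ (w.linear.symm : V →ₗ[ℝ] V)), fun β hβ => ?_, ?_⟩
  · simpa [LinearMap.comp_assoc] using (hH _ (hroot hβ)).preimage hw
  · rw [preimage_iInter₂]
    refine (subset_iInter₂ fun β hβ => iInter₂_subset _ (hroot hβ)).antisymm
      (subset_iInter₂ fun α hα => ?_)
    refine (iInter₂_subset _ (VectorialDatum.comp_mem_roots hlin hα)).trans_eq ?_
    simp [LinearMap.comp_assoc]

section Enclosure

variable {F G : Filter 𝔸}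

theorem IsClosedCell.mem_enclosure {E : Set 𝔸} (hE : D.IsClosedCell E) (hF : E ∈ F) :
    E ∈ D.enclosure F := ⟨E, hF, hE, Subset.rfl⟩

theorem le_enclosure : F ≤ D.enclosure F := fun _ ⟨_, hE, _, hs⟩ => mem_of_superset hE hs

theorem le_enclosure_iff : F ≤ D.enclosure G ↔ ∀ E ∈ G, D.IsClosedCell E → E ∈ F :=
  ⟨fun h _ hG hE => h (hE.mem_enclosure hG),
    fun h _ ⟨E, hG, hE, hs⟩ => mem_of_superset (h E hG hE) hs⟩

theorem enclosure_le_enclosure (h : F ≤ D.enclosure G) : D.enclosure F ≤ D.enclosure G :=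
  le_enclosure_iff.2 fun _ hG hE => hE.mem_enclosure (le_enclosure_iff.1 h _ hG hE)

theorem map_enclosure {w : 𝔸 ≃ᵃ[ℝ] 𝔸} (hw : w ∈ D.weyl) :
    map w (D.enclosure F) = D.enclosure (map w F) := by
  ext S
  constructor
  · rintro ⟨E, hF, hE, hs⟩
    refine ⟨w.symm ⁻¹' E, ?_, hE.preimage (inv_mem hw), fun a ha => ?_⟩
    · change w.symm ∘ w ⁻¹' E ∈ F
      rwa [← AffineEquiv.coe_trans, AffineEquiv.self_trans_symm]
    · simpa using hs ha
  · rintro ⟨E, hF, hE, hs⟩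
    exact ⟨w ⁻¹' E, hF, hE.preimage hw, preimage_mono hs⟩

end Enclosure

section ClosedCell

variable {E : Set 𝔸} {a b c : 𝔸} {e : V}

theorem IsClosedCell.isCell (hE : D.IsClosedCell E) : D.IsCell E := by
  obtain ⟨H, hH, rfl⟩ := hE
  exact ⟨H, fun α hα => Or.inl (hH α hα), rfl⟩

theorem IsClosedCell.isClosed [FiniteDimensional ℝ V] (hE : D.IsClosedCell E) : IsClosed E := by
  obtain ⟨H, hH, rfl⟩ := hE
  refine isClosed_biInter fun α hα => ?_
  rcases hH α hα with h | ⟨p, -, h⟩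
  · exact h ▸ isClosed_univ
  · rw [h]
    exact isClosed_le continuous_const ((LinearMap.continuous_of_finiteDimensional α).comp
      (continuous_id.vsub continuous_const))

theorem IsClosedCell.mem_of_forall_root (hE : D.IsClosedCell E)
    (h : ∀ α ∈ D.roots, ∃ a ∈ E, 0 ≤ α (c -ᵥ a)) : c ∈ E := by
  obtain ⟨H, hH, rfl⟩ := hE
  refine mem_iInter₂.2 fun α hα => ?_
  obtain ⟨a, ha, hac⟩ := h α hα
  have ha' := mem_iInter₂.1 ha α hα
  rcases hH α hα with h | ⟨p, -, h⟩
  · exact h ▸ mem_univ c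
  · rw [h] at ha' ⊢
    change 0 ≤ α (c -ᵥ p)
    rw [← vsub_add_vsub_cancel c a p, map_add]
    exact add_nonneg hac ha'

theorem IsClosedCell.mem_of_between (hE : D.IsClosedCell E) (hD : D.ModeratelyImaginary)
    (he : D.IsRegular e) (ha : a ∈ E) (hb : b ∈ E) (hac : c -ᵥ a ∈ D.closedChamber e)
    (hcb : b -ᵥ c ∈ D.closedChamber e) : c ∈ E := by
  refine hE.mem_of_forall_root fun α hα => ?_
  rcases hD.nonneg_or_nonpos he hα with h | h
  · exact ⟨a, ha, h _ hac⟩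
  · refine ⟨b, hb, ?_⟩
    rw [← neg_vsub_eq_vsub_rev, map_neg]
    exact neg_nonneg.2 (h _ hcb)

theorem IsClosedCell.affineSegment_subset (hE : D.IsClosedCell E) (ha : a ∈ E) (hb : b ∈ E) :
    affineSegment ℝ a b ⊆ E := by
  rintro _ ⟨t, ⟨ht0, ht1⟩, rfl⟩
  refine hE.mem_of_forall_root fun α _ => ?_
  rcases le_total 0 (α (b -ᵥ a)) with h | h
  · refine ⟨a, ha, ?_⟩
    rw [AffineMap.lineMap_vsub_left, map_smul, smul_eq_mul]
    exact mul_nonneg ht0 h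
  · refine ⟨b, hb, ?_⟩
    rw [AffineMap.lineMap_vsub_right, map_smul, smul_eq_mul, ← neg_vsub_eq_vsub_rev, map_neg]
    exact mul_nonneg (sub_nonneg.2 ht1) (neg_nonneg.2 h)

theorem principal_affineSegment_le_enclosure :
    𝓟 (affineSegment ℝ a b) ≤ D.enclosure (𝓟 {a, b}) :=
  le_enclosure_iff.2 fun _ h hE => hE.affineSegment_subset (h (mem_insert _ _))
    (h (mem_insert_of_mem _ rfl))

end ClosedCell

section Facet

variable {x : 𝔸} {Fv : Set V}

theorem nhdsWithin_le_facet : 𝓝[(fun v => v +ᵥ x) '' Fv] x ≤ D.facet x Fv :=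
  fun _ ⟨_, hE, _, hs⟩ => mem_of_superset hE hs

theorem facet_le_enclosure {F : Filter 𝔸}
    (h : 𝓝[(fun v => v +ᵥ x) '' Fv] x ≤ D.enclosure F) : D.facet x Fv ≤ D.enclosure F :=
  le_enclosure_iff.2 fun _ hF hE =>
    ⟨_, le_enclosure_iff.1 h _ hF hE, hE.isCell, Subset.rfl⟩

theorem zero_mem_stdFacet_univ : (0 : V) ∈ D.stdFacet univ :=
  ⟨fun _ _ => map_zero _, fun _ h => (h trivial).elim⟩

theorem pure_le_facet_univ : pure x ≤ D.facet x (D.stdFacet univ) := by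
  have hx : x ∈ (fun v : V => v +ᵥ x) '' D.stdFacet univ :=
    ⟨0, zero_mem_stdFacet_univ, zero_vadd _ _⟩
  exact (pure_le_nhdsWithin hx).trans nhdsWithin_le_facet

theorem facet_univ_le_enclosure_pure (hD : D.ModeratelyImaginary) {e : V} (he : D.IsRegular e) :
    D.facet x (D.stdFacet univ) ≤ D.enclosure (pure x) := by
  refine facet_le_enclosure (le_enclosure_iff.2 fun E hx hE =>
    mem_of_superset self_mem_nhdsWithin ?_)
  rintro _ ⟨v, hv, rfl⟩
  refine hE.mem_of_between hD he hx hx (fun i => ?_) fun i => ?_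
  · rw [vadd_vsub, hv.1 i trivial, mul_zero]
  · rw [vsub_vadd_eq_vsub_sub, vsub_self, zero_sub, map_neg, hv.1 i trivial, neg_zero, mul_zero]

end Facet

/-- The germ of the sectors of direction the chamber of the regular vector `e`, as the germ of a
chimney whose base is the facet `{o}`. -/
def sectorGerm (D : ModelApartment V 𝔸 I) (o : 𝔸) (e : V) : Filter 𝔸 :=
  D.chimneyGerm (D.facet o (D.stdFacet univ)) (D.chamber e)

variable {E S : Set 𝔸} {a b c o x y : 𝔸} {e v : V} {t : ℝ}

theorem vsub_self_mem_closedChamber (x : 𝔸) : x -ᵥ x ∈ D.closedChamber e := fun i => by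
  rw [vsub_self, map_zero, mul_zero]

theorem smul_vadd_vsub_mem_closedChamber (ht : 0 ≤ t) (hxy : y -ᵥ x ∈ D.closedChamber e) :
    (t • e +ᵥ y) -ᵥ x ∈ D.closedChamber e := by
  rw [vadd_vsub_assoc]
  exact SimpleRoots.add_mem_closedChamber
    (SimpleRoots.smul_mem_closedChamber ht SimpleRoots.self_mem_closedChamber) hxy

theorem vsub_smul_vadd_mem_closedChamber_neg (ht : 0 ≤ t) :
    x -ᵥ (t • e +ᵥ x) ∈ D.closedChamber (-e) := by
  rw [vsub_vadd_eq_vsub_sub, vsub_self, zero_sub, ← smul_neg]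
  exact SimpleRoots.smul_mem_closedChamber ht SimpleRoots.self_mem_closedChamber

theorem isFacet_facet_univ : D.IsFacet (D.facet o (D.stdFacet univ)) :=
  ⟨o, _, SimpleRoots.isVectorialFacet_stdFacet univ, rfl⟩

theorem isSplayedChimneyGerm_sectorGerm (he : D.IsRegular e) :
    D.IsSplayedChimneyGerm (D.sectorGerm o e) :=
  ⟨_, _, isFacet_facet_univ, he.isSphericalFacet_chamber, rfl⟩

theorem image_vadd_subset_of_mem_chimney {F : Filter 𝔸} {Fv : Set V} (hx : pure x ≤ F)
    (hS : S ∈ D.chimney F Fv) : (fun v => v +ᵥ x) '' Fv ⊆ S := by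
  have hmap : map₂ (fun v a => v +ᵥ a) (𝓟 Fv) (pure x) ≤ D.chimney F Fv :=
    (map₂_mono_left hx).trans le_enclosure
  simpa using hmap hS

theorem rayGerm_le_facet (he : D.IsRegular e) : rayGerm x e ≤ D.facet x (D.chamber e) := by
  refine (tendsto_nhdsWithin_iff.2 ⟨rayGerm_le_nhds, ?_⟩).trans nhdsWithin_le_facet
  filter_upwards [self_mem_nhdsWithin] with t ht
  exact ⟨t • e, he.smul_mem_chamber ht, rfl⟩

theorem isSolid_of_support_eq_top {F : Filter 𝔸} (h : support F = (⊤ : AffineSubspace ℝ 𝔸)) :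
    D.IsSolid F := by
  refine (finite_singleton (1 : V ≃ₗ[ℝ] V)).subset ?_
  rintro w ⟨-, hw⟩
  rw [h, AffineSubspace.direction_top] at hw
  exact LinearEquiv.ext fun v => hw v trivial

variable [FiniteDimensional ℝ V]

theorem IsClosedCell.mem_nhds (hE : D.IsClosedCell E) (hD : D.ModeratelyImaginary)
    (he : D.IsRegular e) (ha : a ∈ E) (hb : b ∈ E) (hac : c -ᵥ a ∈ D.chamber e)
    (hcb : b -ᵥ c ∈ D.chamber e) : E ∈ 𝓝 c := by
  have hopen := D.isOpen_chamber e
  have hleft : ∀ᶠ p in 𝓝 c, p -ᵥ a ∈ D.chamber e :=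
    (continuous_id.vsub continuous_const).continuousAt.eventually_mem (hopen.mem_nhds hac)
  have hright : ∀ᶠ p in 𝓝 c, b -ᵥ p ∈ D.chamber e :=
    (continuous_const.vsub continuous_id).continuousAt.eventually_mem (hopen.mem_nhds hcb)
  filter_upwards [hleft, hright] with p hap hpb
  exact hE.mem_of_between hD he ha hb (SimpleRoots.chamber_subset_closedChamber hap)
    (SimpleRoots.chamber_subset_closedChamber hpb)

theorem IsClosedCell.mem_rayGerm (hE : D.IsClosedCell E) :
    E ∈ rayGerm x v ↔ x ∈ E ∧ ∃ ε > (0 : ℝ), ε • v +ᵥ x ∈ E := by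
  constructor
  · intro h
    have hev : ∀ᶠ t : ℝ in 𝓝[>] 0, t • v +ᵥ x ∈ E := h
    exact ⟨hE.isClosed.mem_of_tendsto rayGerm_le_nhds hev,
      (eventually_mem_nhdsWithin.and hev).exists⟩
  · rintro ⟨hx, ε, hε, hxε⟩
    have hev : ∀ᶠ t : ℝ in 𝓝[>] 0, t • v +ᵥ x ∈ E := by
      filter_upwards [Ioo_mem_nhdsGT hε] with t ht
      refine hE.affineSegment_subset hx hxε
        ⟨t / ε, ⟨(div_pos ht.1 hε).le, (div_le_one hε).2 ht.2.le⟩, ?_⟩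
      rw [AffineMap.lineMap_apply, vadd_vsub, smul_smul, div_mul_cancel₀ _ hε.ne']
    exact hev

theorem pure_le_enclosure_rayGerm : pure x ≤ D.enclosure (rayGerm x v) :=
  le_enclosure_iff.2 fun _ h hE => (hE.mem_rayGerm.1 h).1

theorem facet_le_enclosure_rayGerm (hD : D.ModeratelyImaginary) (he : D.IsRegular e) :
    D.facet x (D.chamber e) ≤ D.enclosure (rayGerm x e) := by
  refine facet_le_enclosure (le_enclosure_iff.2 fun E h hE => ?_)
  obtain ⟨hx, ε, hε, hxε⟩ := hE.mem_rayGerm.1 h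
  have hright : ∀ᶠ p in 𝓝 x, (ε • e +ᵥ x) -ᵥ p ∈ D.chamber e :=
    (continuous_const.vsub continuous_id).continuousAt.eventually_mem
      ((D.isOpen_chamber e).mem_nhds (by simpa using he.smul_mem_chamber hε))
  filter_upwards [mem_nhdsWithin_of_mem_nhds hright, self_mem_nhdsWithin]
  rintro _ hpb ⟨v, hv, rfl⟩
  refine hE.mem_of_between hD he hx hxε ?_ (SimpleRoots.chamber_subset_closedChamber hpb)
  rw [vadd_vsub]
  exact SimpleRoots.chamber_subset_closedChamber hv

theorem eventually_mem_enclosure_nhds_of_rayGerm (hD : D.ModeratelyImaginary)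
    (he : D.IsRegular e) (hS : S ∈ D.enclosure (rayGerm b e)) :
    ∀ᶠ t : ℝ in 𝓝[>] 0, S ∈ D.enclosure (𝓝 (t • e +ᵥ b)) := by
  obtain ⟨E, hb, hE, hs⟩ := hS
  obtain ⟨hb, ε, hε, hbε⟩ := hE.mem_rayGerm.1 hb
  filter_upwards [Ioo_mem_nhdsGT hε] with t ht
  refine ⟨E, hE.mem_nhds hD he hb hbε ?_ ?_, hE, hs⟩
  · rw [vadd_vsub]
    exact he.smul_mem_chamber ht.1
  · rw [vadd_vsub_vadd_cancel_right, ← sub_smul]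
    exact he.smul_mem_chamber (sub_pos.2 ht.2)

theorem isOpen_image_vadd_chamber : IsOpen ((fun v => v +ᵥ o) '' D.chamber e) :=
  (Homeomorph.vaddConst o).isOpenMap _ (D.isOpen_chamber e)

theorem eventually_mem_enclosure_nhds_of_sectorGerm (he : D.IsRegular e)
    (hS : S ∈ D.sectorGerm o e) (x : 𝔸) :
    ∀ᶠ t : ℝ in atTop, S ∈ D.enclosure (𝓝 (t • e +ᵥ x)) := by
  suffices atTop.bind (fun t : ℝ => D.enclosure (𝓝 (t • e +ᵥ x))) ≤ D.sectorGerm o e from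
    mem_bind'.1 (this hS)
  refine le_iInf₂ fun ξ _ => fun S ⟨E, hmem, hE, hs⟩ => mem_bind'.2 ?_
  have hξ : pure (ξ +ᵥ o) ≤ map (fun a => ξ +ᵥ a) (D.facet o (D.stdFacet univ)) :=
    map_mono pure_le_facet_univ
  filter_upwards [he.eventually_add_smul_mem_chamber (x -ᵥ (ξ +ᵥ o))] with t ht
  rw [add_comm, ← vadd_vsub_assoc] at ht
  refine ⟨E, mem_of_superset (isOpen_image_vadd_chamber.mem_nhds ⟨_, ht, vsub_vadd _ _⟩)
    (image_vadd_subset_of_mem_chimney hξ (hE.mem_enclosure hmem)), hE, hs⟩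

theorem support_chimney_chamber (he : D.IsRegular e) :
    support (D.chimney (D.facet o (D.stdFacet univ)) (D.chamber e)) = ⊤ := by
  refine sInf_eq_top.2 fun M hM => eq_top_iff.2 ?_
  rw [← isOpen_image_vadd_chamber.affineSpan_eq_top ⟨_, e, he.self_mem_chamber, rfl⟩]
  exact affineSpan_le.2 (image_vadd_subset_of_mem_chimney pure_le_facet_univ hM)

theorem isSolidChimneyGerm_sectorGerm (he : D.IsRegular e) :
    D.IsSolidChimneyGerm (D.sectorGerm o e) :=
  ⟨_, _, isFacet_facet_univ, he.isVectorialFacet_chamber,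
    isSolid_of_support_eq_top (support_chimney_chamber he), rfl⟩

theorem IsClosedCell.mem_of_mem_sectorGerm (hE : D.IsClosedCell E) (hD : D.ModeratelyImaginary)
    (he : D.IsRegular e) (ho : E ∈ D.sectorGerm o e) (hx : x ∈ E)
    (hy : y -ᵥ x ∈ D.closedChamber e) : y ∈ E := by
  obtain ⟨t, hmem, ht⟩ := ((eventually_mem_enclosure_nhds_of_sectorGerm he ho x).and
    (he.eventually_add_smul_mem_chamber (x -ᵥ y))).exists
  rw [add_comm, ← vadd_vsub_assoc] at ht
  exact hE.mem_of_between hD he hx (mem_of_mem_nhds (le_enclosure hmem)) hy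
    (SimpleRoots.chamber_subset_closedChamber ht)

theorem principal_pair_le_enclosure_sectorGerm_sup_pure (hD : D.ModeratelyImaginary)
    (he : D.IsRegular e) (hxy : y -ᵥ x ∈ D.closedChamber e) :
    𝓟 {x, y} ≤ D.enclosure (D.sectorGerm o e ⊔ pure x) :=
  le_enclosure_iff.2 fun _ h hE => mem_principal.2
    (pair_subset h.2 (hE.mem_of_mem_sectorGerm hD he h.1 h.2 hxy))

theorem rayGerm_le_enclosure_sectorGerm_sup_pure (hD : D.ModeratelyImaginary)
    (he : D.IsRegular e) (hxy : y -ᵥ x ∈ D.closedChamber e) :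
    rayGerm y e ≤ D.enclosure (D.sectorGerm o e ⊔ pure x) :=
  le_enclosure_iff.2 fun _ h hE => hE.mem_rayGerm.2
    ⟨hE.mem_of_mem_sectorGerm hD he h.1 h.2 hxy, 1, one_pos,
      hE.mem_of_mem_sectorGerm hD he h.1 h.2 (smul_vadd_vsub_mem_closedChamber zero_le_one hxy)⟩

theorem sectorGerm_neg_sup_rayGerm_le_enclosure_pure (hD : D.ModeratelyImaginary)
    (he : D.IsRegular e) (ht : 0 < t) :
    D.sectorGerm o (-e) ⊔ rayGerm x e ≤ D.enclosure (D.sectorGerm o (-e) ⊔ pure (t • e +ᵥ x)) :=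
  le_enclosure_iff.2 fun _ h hE => ⟨h.1, hE.mem_rayGerm.2
    ⟨hE.mem_of_mem_sectorGerm hD he.neg h.1 h.2 (vsub_smul_vadd_mem_closedChamber_neg ht.le),
      t, ht, h.2⟩⟩

theorem sectorGerm_neg_sup_rayGerm_le_enclosure_rayGerm (hD : D.ModeratelyImaginary)
    (he : D.IsRegular e) (ht : 0 ≤ t) :
    D.sectorGerm o (-e) ⊔ rayGerm x e ≤
      D.enclosure (D.sectorGerm o (-e) ⊔ rayGerm (t • e +ᵥ x) e) := by
  refine le_enclosure_iff.2 fun E h hE => ?_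
  obtain ⟨-, ε, hε, hxε⟩ := hE.mem_rayGerm.1 h.2
  rw [vadd_vadd, ← add_smul] at hxε
  exact le_enclosure_iff.1
    (sectorGerm_neg_sup_rayGerm_le_enclosure_pure hD he (by positivity)) E ⟨h.1, hxε⟩ hE

end ModelApartment

theorem real_induction {P : ℝ → Prop} (zero : P 0)
    (right : ∀ t, 0 ≤ t → P t → ∀ᶠ s in 𝓝[>] t, P s)
    (left : ∀ t, 0 < t → (∀ s ∈ Ico 0 t, P s) → P t) {t : ℝ} (ht : 0 ≤ t) : P t := by
  by_contra hPt
  set B : Set ℝ := {s | 0 ≤ s ∧ ¬P s}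
  have hne : B.Nonempty := ⟨t, ht, hPt⟩
  have hbdd : BddBelow B := ⟨0, fun s hs => hs.1⟩
  have hbelow : ∀ s ∈ Ico 0 (sInf B), P s := fun s hs => by
    by_contra hPs
    exact notMem_of_lt_csInf hs.2 hbdd ⟨hs.1, hPs⟩
  have h0 : 0 ≤ sInf B := Real.sInf_nonneg fun s hs => hs.1
  have hinf : P (sInf B) := by
    rcases h0.eq_or_lt with h | h
    · exact h ▸ zero
    · exact left _ h hbelow
  obtain ⟨u, hu, hIoo⟩ := mem_nhdsGT_iff_exists_Ioo_subset.1 (right _ h0 hinf)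
  obtain ⟨b, hb, hbu⟩ := exists_lt_of_csInf_lt hne hu
  have hlt : sInf B < b := (csInf_le hbdd hb).lt_of_ne fun h => hb.2 (h ▸ hinf)
  exact hb.2 (hIoo ⟨hlt, hbu⟩)

namespace ApartmentSystem

theorem range_isom {𝔸 X : Type*} {A : Set X} (f : 𝔸 ≃ A) : range (fun p => (f p : X)) = A :=
  (f.surjective.range_comp Subtype.val).trans Subtype.range_val

variable {V 𝔸 I X : Type*} [NormedAddCommGroup V] [NormedSpace ℝ V]
  [MetricSpace 𝔸] [NormedAddTorsor V 𝔸] [Fintype I] {D : ModelApartment V 𝔸 I}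
  (H : ApartmentSystem D X)

/-- The charts: the isomorphisms from `𝔸` to an apartment, as maps to `X`. -/
def IsChart (f : 𝔸 → X) : Prop :=
  ∃ A ∈ H.apartments, ∃ e ∈ H.isom A, f = fun p => (e p : X)

/-- The filter `F` on `𝔸` satisfies the conclusion of (MA2) and (MA4): as soon as the image of `F`
in an apartment lies in a second one, the two apartments share its enclosure, up to an isomorphism
that fixes it. The isomorphism `φ` of the axioms is encoded by the chart `k = φ ∘ f`. -/
def IsIntrinsic (F : Filter 𝔸) : Prop :=
  ∀ ⦃f g : 𝔸 → X⦄, H.IsChart f → H.IsChart g → (∀ᶠ p in F, f p ∈ range g) →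
    ∃ k, H.IsChart k ∧ range k = range g ∧ f =ᶠ[D.enclosure F] k

variable {H} {f g h j : 𝔸 → X} {A A' : Set X} {F G G' : Filter 𝔸} {e e' v v' : V}
  {o p p' q q' x y : 𝔸} {t : ℝ}

open ModelApartment

namespace IsChart

theorem range_mem (hf : H.IsChart f) : range f ∈ H.apartments := by
  obtain ⟨A, hA, e, -, rfl⟩ := hf
  rwa [range_isom]

theorem exists_isom (hf : H.IsChart f) : ∃ e ∈ H.isom (range f), f = fun p => (e p : X) := by
  obtain ⟨A, -, e, he, rfl⟩ := hf
  rw [range_isom]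
  exact ⟨e, he, rfl⟩

theorem injective (hf : H.IsChart f) : Function.Injective f := by
  obtain ⟨A, -, e, -, rfl⟩ := hf
  exact Subtype.val_injective.comp e.injective

theorem comp_weyl (hf : H.IsChart f) {w : 𝔸 ≃ᵃ[ℝ] 𝔸} (hw : w ∈ D.weyl) :
    H.IsChart (f ∘ w) := by
  obtain ⟨A, hA, e, he, rfl⟩ := hf
  exact ⟨A, hA, w.toEquiv.trans e, (H.mem_isom_iff A hA e he _).2 ⟨w, hw, rfl⟩, rfl⟩

theorem exists_weyl_of_isom (hf : H.IsChart f) {e : 𝔸 ≃ range f} (he : e ∈ H.isom (range f)) :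
    ∃ w ∈ D.weyl, ∀ p, (e p : X) = f (w p) := by
  obtain ⟨e', he', hfe⟩ := hf.exists_isom
  obtain ⟨w, hw, rfl⟩ := (H.mem_isom_iff _ hf.range_mem e' he' e).1 he
  exact ⟨w, hw, fun p => (congrFun hfe (w p)).symm⟩

theorem exists_weyl (hf : H.IsChart f) (hg : H.IsChart g) (h : range g = range f) :
    ∃ w ∈ D.weyl, g = f ∘ w := by
  obtain ⟨e, he, hge⟩ := hg.exists_isom
  revert e
  rw [h]
  intro e he hge
  obtain ⟨w, hw, hew⟩ := hf.exists_weyl_of_isom he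
  exact ⟨w, hw, hge.trans (funext hew)⟩

theorem isIn (hf : H.IsChart f) {P : Filter 𝔸 → Prop} {F : Filter 𝔸} (hF : P F) :
    H.IsIn P (range f) (map f F) := by
  obtain ⟨e, he, hfe⟩ := hf.exists_isom
  exact ⟨e, he, F, hF, by rw [← hfe]⟩

theorem enclosure_map (hf : H.IsChart f) :
    H.enclosure (range f) (map f F) = map f (D.enclosure F) := by
  have hterm : ∀ e ∈ H.isom (range f),
      map (fun p => (e p : X)) (D.enclosure (comap (fun p => (e p : X)) (map f F))) =
        map f (D.enclosure F) := by
    intro e he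
    obtain ⟨w, hw, hew⟩ := hf.exists_weyl_of_isom he
    rw [show (fun p => (e p : X)) = f ∘ w from funext hew, ← comap_comap, comap_map hf.injective,
      ← map_map, ModelApartment.map_enclosure hw, map_comap_of_surjective w.surjective]
  obtain ⟨e, he, -⟩ := hf.exists_isom
  exact le_antisymm (iSup₂_le fun e he => (hterm e he).le)
    ((hterm e he).ge.trans (le_iSup₂_of_le e he le_rfl))

end IsChart

theorem trans_mem_isom (hA : A ∈ H.apartments) (hA' : A' ∈ H.apartments) {φ : A ≃ A'}
    (hφ : H.IsIso A A' φ) {e : 𝔸 ≃ A} (he : e ∈ H.isom A) : e.trans φ ∈ H.isom A' := by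
  obtain ⟨f, hf, hfφ⟩ := hφ
  obtain ⟨w, hw, rfl⟩ := (H.mem_isom_iff A hA f hf e).1 he
  exact (H.mem_isom_iff A' hA' _ hfφ _).2 ⟨w, hw, rfl⟩

theorem IsChart.exists_iso_fixes_iff (hf : H.IsChart f) (hA' : A' ∈ H.apartments)
    {F : Filter 𝔸} :
    (∃ φ : range f ≃ A', H.IsIso (range f) A' φ ∧
        Fixes φ (H.enclosure (range f) (map f F))) ↔
      ∃ k, H.IsChart k ∧ range k = A' ∧ f =ᶠ[D.enclosure F] k := by
  obtain ⟨e, he, hfe⟩ := hf.exists_isom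
  have hmem : ∀ p, e p = ⟨f p, mem_range_self p⟩ := fun p => Subtype.ext (congrFun hfe p).symm
  rw [hf.enclosure_map]
  constructor
  · rintro ⟨φ, hφ, hfix⟩
    refine ⟨fun p => (φ (e p) : X),
      ⟨A', hA', _, trans_mem_isom hf.range_mem hA' hφ he, rfl⟩, range_isom (e.trans φ), ?_⟩
    filter_upwards [mem_map.1 hfix] with p ⟨_, hp⟩
    rw [hmem, hp]
  · rintro ⟨k, hk, rfl, hfk⟩
    obtain ⟨e', he', hke⟩ := hk.exists_isom
    refine ⟨e.symm.trans e', ⟨e, he, ?_⟩, mem_map.2 ?_⟩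
    · rwa [← Equiv.trans_assoc, Equiv.self_trans_symm, Equiv.refl_trans]
    · filter_upwards [hfk] with p hp
      refine ⟨mem_range_self p, ?_⟩
      rw [← hmem, Equiv.trans_apply, Equiv.symm_apply_apply, hp]
      exact (congrFun hke p).symm

theorem IsIntrinsic.sup_of_le_enclosure (hFG : H.IsIntrinsic (F ⊔ G)) (hG' : H.IsIntrinsic G')
    (h : G ≤ D.enclosure G') (h' : G' ≤ D.enclosure G) : H.IsIntrinsic (F ⊔ G') := by
  intro f g hf hg hrange
  obtain ⟨j, -, hjg, hfj⟩ := hG' hf hg (eventually_sup.1 hrange).2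
  have hG : ∀ᶠ p in G, f p ∈ range g := by
    filter_upwards [hfj.filter_mono h] with p hp
    exact hjg ▸ hp ▸ mem_range_self p
  obtain ⟨k, hk, hkg, hfk⟩ := hFG hf hg (eventually_sup.2 ⟨(eventually_sup.1 hrange).1, hG⟩)
  refine ⟨k, hk, hkg, hfk.filter_mono (enclosure_le_enclosure (sup_le ?_ ?_))⟩
  · exact le_sup_left.trans le_enclosure
  · exact h'.trans (enclosure_le_enclosure (le_sup_right.trans le_enclosure))

theorem IsIntrinsic.map (hF : H.IsIntrinsic F) {w : 𝔸 ≃ᵃ[ℝ] 𝔸} (hw : w ∈ D.weyl) :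
    H.IsIntrinsic (map w F) := by
  intro f g hf hg hrange
  obtain ⟨k, hk, hkg, hfk⟩ := hF (hf.comp_weyl hw) hg hrange
  refine ⟨k ∘ w.symm, hk.comp_weyl (D.weyl.inv_mem hw),
    (w.symm.surjective.range_comp k).trans hkg, ?_⟩
  rw [← map_enclosure hw]
  exact eventually_map.2 (hfk.mono fun p hp => by rwa [Function.comp_apply, w.symm_apply_apply])

theorem exists_isChart_eventuallyEq_of_eqOn {k l m : 𝔸 → X} {S : Set 𝔸} (hk : H.IsChart k)
    (hl : H.IsChart l) (hm : H.IsChart m) (hlm : range l = range m)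
    (hfl : f =ᶠ[D.enclosure (𝓟 S)] l) (hkm : k =ᶠ[D.enclosure (𝓟 S)] m) (hfk : EqOn f k S) :
    ∃ k', H.IsChart k' ∧ range k' = range k ∧ f =ᶠ[D.enclosure (𝓟 S)] k' := by
  obtain ⟨w, hw, rfl⟩ := hm.exists_weyl hl hlm
  have hfl' : EqOn f (m ∘ w) S := hfl.filter_mono le_enclosure
  have hkm' : EqOn k m S := hkm.filter_mono le_enclosure
  have hwS : EqOn w id S := fun p hp =>
    hm.injective ((hfl' hp).symm.trans ((hfk hp).trans (hkm' hp)))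
  have hmap : map w (D.enclosure (𝓟 S)) = D.enclosure (𝓟 S) := by
    rw [map_enclosure hw, map_principal, hwS.image_eq, image_id]
  refine ⟨k ∘ w, hk.comp_weyl hw, w.surjective.range_comp k, hfl.trans ?_⟩
  rw [← hmap] at hkm
  exact (eventually_map.1 hkm).mono fun p hp => hp.symm

namespace IsAffineHovel

theorem isIntrinsic_pure (hH : H.IsAffineHovel) (x : 𝔸) : H.IsIntrinsic (pure x) := by
  intro f g hf hg hx
  refine (hf.exists_iso_fixes_iff hg.range_mem).1
    (hH.MA2 _ hf.range_mem _ (Or.inl ⟨f x, mem_range_self x, ?_⟩) _ hg.range_mem hx).2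
  rw [map_pure, principal_singleton]

theorem isIntrinsic_rayGerm (hH : H.IsAffineHovel) (hv : D.IsComparable v) (hv0 : v ≠ 0)
    (p : 𝔸) : H.IsIntrinsic (rayGerm p v) := by
  intro f g hf hg hrange
  have hgerm : D.IsPreorderedIntervalGerm (rayGerm p v) := by
    refine ⟨p, v +ᵥ p, ?_, ?_, (nhdsWithin_affineSegment_diff hv0).symm⟩
    · exact fun h => hv0 (vadd_right_cancel p (h.symm.trans (zero_vadd V p).symm))
    · rwa [ModelApartment.Le, ModelApartment.Le, vadd_vsub, vsub_vadd_eq_vsub_sub, vsub_self,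
        zero_sub]
  exact (hf.exists_iso_fixes_iff hg.range_mem).1
    (hH.MA2 _ hf.range_mem _ (Or.inr (Or.inl (hf.isIn hgerm))) _ hg.range_mem hrange).2

theorem exists_chart (hH : H.IsAffineHovel) (hf : H.IsChart f) (hg : H.IsChart g)
    (hF : D.IsSplayedChimneyGerm F) (hG : D.IsFacet G ∨ D.IsSolidChimneyGerm G) :
    ∃ k, H.IsChart k ∧ (∀ᶠ p in F, f p ∈ range k) ∧ ∀ᶠ p in G, g p ∈ range k := by
  obtain ⟨A, hA, hFA, hGA⟩ := hH.MA3 _ hf.range_mem _ hg.range_mem _ _ (hf.isIn hF)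
    (hG.imp hg.isIn hg.isIn)
  obtain ⟨e, he⟩ := H.isom_nonempty A hA
  exact ⟨fun p => (e p : X), ⟨A, hA, e, he, rfl⟩, by rwa [range_isom], by rwa [range_isom]⟩

theorem isIntrinsic_sup (hH : H.IsAffineHovel) (hF : D.IsSplayedChimneyGerm F)
    (hG : D.IsFacet G ∨ D.IsSolidChimneyGerm G) : H.IsIntrinsic (F ⊔ G) := by
  intro f g hf hg hrange
  refine (hf.exists_iso_fixes_iff hg.range_mem).1 ?_
  rw [map_sup]
  exact (hH.MA4 _ hf.range_mem _ hf.range_mem _ _ (hf.isIn hF) (hG.imp hf.isIn hf.isIn)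
    _ hf.range_mem _ hg.range_mem range_mem_map range_mem_map (eventually_sup.1 hrange).1
    (eventually_sup.1 hrange).2).2

theorem isIntrinsic_sectorGerm_sup_pure (hH : H.IsAffineHovel) (hD : D.ModeratelyImaginary)
    (he : D.IsRegular e) : H.IsIntrinsic (D.sectorGerm o e ⊔ pure x) :=
  (hH.isIntrinsic_sup (isSplayedChimneyGerm_sectorGerm he)
      (Or.inl isFacet_facet_univ)).sup_of_le_enclosure (hH.isIntrinsic_pure x)
    (facet_univ_le_enclosure_pure hD he) (pure_le_facet_univ.trans le_enclosure)

end IsAffineHovel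

theorem IsChart.segmentIn_eq (hf : H.IsChart f) (p q : 𝔸) :
    H.segmentIn (range f) (f p) (f q) = f '' affineSegment ℝ p q := by
  ext z
  constructor
  · rintro ⟨e, he, p', q', hp, hq, m, hm, rfl⟩
    obtain ⟨w, -, hew⟩ := hf.exists_weyl_of_isom he
    rw [hew] at hp hq ⊢
    rw [← hf.injective hp, ← hf.injective hq]
    exact mem_image_of_mem f
      ((affineSegment_image (w : 𝔸 →ᵃ[ℝ] 𝔸) p' q').subset (mem_image_of_mem w hm))
  · rintro ⟨m, hm, rfl⟩
    obtain ⟨e, he, hfe⟩ := hf.exists_isom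
    have hef : ∀ a, (e a : X) = f a := fun a => (congrFun hfe a).symm
    exact ⟨e, he, p, q, hef p, hef q, m, hm, hef m⟩

namespace IsOrdered

theorem image_affineSegment_eq (hO : H.IsOrdered) (hf : H.IsChart f) (hg : H.IsChart g)
    (hpq : D.Le p q) (hp : f p = g p') (hq : f q = g q') :
    f '' affineSegment ℝ p q = g '' affineSegment ℝ p' q' := by
  obtain ⟨e, he, hfe⟩ := hf.exists_isom
  have hef : ∀ a, (e a : X) = f a := fun a => (congrFun hfe a).symm
  have hseg := hO (f p) (f q) _ hf.range_mem _ hg.range_mem (mem_range_self p)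
    (mem_range_self q) (hp ▸ mem_range_self p') (hq ▸ mem_range_self q')
    ⟨e, he, p, q, hef p, hef q, hpq⟩
  rwa [hf.segmentIn_eq, hp, hq, hg.segmentIn_eq] at hseg

theorem exists_eq_smul_vadd (hO : H.IsOrdered) (hf : H.IsChart f) (hg : H.IsChart g)
    (hv : D.IsComparable v) (hp : f p = g p') (hvp : f (v +ᵥ p) = g (v' +ᵥ p'))
    (ht : t ∈ Icc (0 : ℝ) 1) : ∃ s ∈ Icc (0 : ℝ) 1, f (t • v +ᵥ p) = g (s • v' +ᵥ p') := by
  have hseg : f '' affineSegment ℝ p (v +ᵥ p) = g '' affineSegment ℝ p' (v' +ᵥ p') := by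
    rcases hv with hv | hv
    · refine hO.image_affineSegment_eq hf hg ?_ hp hvp
      rwa [ModelApartment.Le, vadd_vsub]
    · rw [affineSegment_comm, affineSegment_comm ℝ p']
      refine hO.image_affineSegment_eq hf hg ?_ hvp hp
      rwa [ModelApartment.Le, vsub_vadd_eq_vsub_sub, vsub_self, zero_sub]
  have hmem : f (t • v +ᵥ p) ∈ f '' affineSegment ℝ p (v +ᵥ p) :=
    mem_image_of_mem f ⟨t, ht, by rw [AffineMap.lineMap_apply, vadd_vsub]⟩
  obtain ⟨_, ⟨s, hs, rfl⟩, hfs⟩ := hseg ▸ hmem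
  rw [AffineMap.lineMap_apply, vadd_vsub] at hfs
  exact ⟨s, hs, hfs.symm⟩

theorem eventually_exists_eq_smul_vadd {a b : ℝ} (hO : H.IsOrdered) (hf : H.IsChart f)
    (hg : H.IsChart g) (hv : D.IsComparable v) (hp : f p = g p) (ha : 0 < a) (hb : 0 ≤ b)
    (hq : f (a • v +ᵥ p) = g (b • v +ᵥ p)) :
    ∀ᶠ t : ℝ in 𝓝[>] 0, ∃ s : ℝ, 0 ≤ s ∧ f (t • v +ᵥ p) = g (s • v +ᵥ p) := by
  filter_upwards [Ioo_mem_nhdsGT ha] with t ht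
  obtain ⟨s, hs, hfs⟩ := hO.exists_eq_smul_vadd hf hg (hv.smul ha.le) hp hq
    ⟨(div_pos ht.1 ha).le, (div_le_one ha).2 ht.2.le⟩
  rw [smul_smul, div_mul_cancel₀ _ ha.ne', smul_smul] at hfs
  exact ⟨s * b, mul_nonneg hs.1 hb, hfs⟩

end IsOrdered

variable [FiniteDimensional ℝ V]

theorem IsAffineHovel.isIntrinsic_sectorGerm_sup_rayGerm (hH : H.IsAffineHovel)
    (hD : D.ModeratelyImaginary) (he : D.IsRegular e) (he' : D.IsRegular e') :
    H.IsIntrinsic (D.sectorGerm o e ⊔ rayGerm x e') :=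
  (hH.isIntrinsic_sup (isSplayedChimneyGerm_sectorGerm he)
      (Or.inl ⟨x, _, he'.isVectorialFacet_chamber, rfl⟩)).sup_of_le_enclosure
    (hH.isIntrinsic_rayGerm (he'.isComparable SimpleRoots.self_mem_closedChamber) he'.1 x)
    (facet_le_enclosure_rayGerm hD he') ((rayGerm_le_facet he').trans le_enclosure)

theorem eventuallyEq_rayGerm_of_eq {a b : ℝ} (hH : H.IsAffineHovel) (hO : H.IsOrdered)
    (hf : H.IsChart f) (hg : H.IsChart g) (hv : D.IsComparable v) (hv0 : v ≠ 0) (hp : f p = g p)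
    (ha : 0 < a) (hb : 0 ≤ b) (hq : f (a • v +ᵥ p) = g (b • v +ᵥ p)) : f =ᶠ[rayGerm p v] g := by
  have hmem := hO.eventually_exists_eq_smul_vadd hf hg hv hp ha hb hq
  obtain ⟨k, hk, hkg, hfk⟩ := hH.isIntrinsic_rayGerm hv hv0 p hf hg
    (hmem.mono fun t ⟨s, _, hs⟩ => ⟨_, hs.symm⟩)
  obtain ⟨w, hw, rfl⟩ := hg.exists_weyl hk hkg
  have hwp : w p = p := hg.injective
    ((hfk.filter_mono pure_le_enclosure_rayGerm : f p = g (w p)).symm.trans hp)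
  have hmap : ∀ t : ℝ, w (t • v +ᵥ p) = t • w.linear v +ᵥ p := fun t => by
    rw [AffineEquiv.map_vadd, map_smul, hwp]
  have hray : ∀ᶠ t : ℝ in 𝓝[>] 0, f (t • v +ᵥ p) = g (w (t • v +ᵥ p)) :=
    hfk.filter_mono le_enclosure
  obtain ⟨t, ht, ⟨s, hs, hfs⟩, hft⟩ :=
    (eventually_mem_nhdsWithin.and (hmem.and hray)).exists
  have hws : t • w.linear v = s • v :=
    vadd_right_cancel p (hg.injective (by rw [← hmap, ← hft, hfs]))
  have hwv : w.linear v = (s / t) • v := by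
    rw [div_eq_inv_mul, mul_smul, ← hws, inv_smul_smul₀ (ne_of_gt ht)]
  have hc : s / t = 1 := VectorialDatum.eq_one_of_apply_eq_smul hv hv0
    (linear_mem_vectorialWeyl hw) (div_nonneg hs (le_of_lt ht)) hwv
  refine hray.mono fun t ht => ht.trans ?_
  rw [hmap, hwv, hc, one_smul]

theorem eq_of_eventuallyEq_rayGerm (hH : H.IsAffineHovel) (hf : H.IsChart f) (hg : H.IsChart g)
    (hv : D.IsComparable v) (hv0 : v ≠ 0) (h : f =ᶠ[rayGerm p v] g) : f p = g p := by
  obtain ⟨k, hk, hkg, hfk⟩ := hH.isIntrinsic_rayGerm hv hv0 p hf hg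
    (h.mono fun q hq => hq ▸ mem_range_self q)
  obtain ⟨w, -, rfl⟩ := hg.exists_weyl hk hkg
  have hfix : ∀ᶠ t : ℝ in 𝓝[>] 0, w (t • v +ᵥ p) = t • v +ᵥ p := by
    filter_upwards [h, hfk.filter_mono le_enclosure] with q hq hq'
    exact hg.injective (hq'.symm.trans hq)
  have hw : Continuous w := (w : 𝔸 →ᵃ[ℝ] 𝔸).continuous_of_finiteDimensional
  have hwp : w p = p := (isClosed_eq hw continuous_id).mem_of_tendsto rayGerm_le_nhds hfix
  exact (hfk.filter_mono pure_le_enclosure_rayGerm : f p = g (w p)).trans (congrArg g hwp)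

theorem eventuallyEq_rayGerm_smul_vadd {b : ℝ} (hH : H.IsAffineHovel) (hO : H.IsOrdered)
    (hf : H.IsChart f) (hg : H.IsChart g) (hv : D.IsComparable v) (hv0 : v ≠ 0) (hp : f p = g p)
    (hb : 0 ≤ b) (hq : f (v +ᵥ p) = g (b • v +ᵥ p)) (ht : t ∈ Ico (0 : ℝ) 1)
    (heq : f (t • v +ᵥ p) = g (t • v +ᵥ p)) : f =ᶠ[rayGerm (t • v +ᵥ p) v] g := by
  obtain ⟨s, hs, hfs⟩ := hO.exists_eq_smul_vadd hf hg hv hp hq (Ico_subset_Icc_self ht)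
  have hts : t = s * b := smul_left_injective ℝ hv0
    (vadd_right_cancel p (hg.injective (by rw [← heq, hfs, smul_smul])))
  have htb : t ≤ b := hts.trans_le (mul_le_of_le_one_left hb hs.2)
  refine eventuallyEq_rayGerm_of_eq hH hO hf hg hv hv0 heq (sub_pos.2 ht.2) (sub_nonneg.2 htb) ?_
  rw [vadd_vadd, vadd_vadd, ← add_smul, ← add_smul, sub_add_cancel, sub_add_cancel, one_smul, hq]

theorem eq_of_eq_smul_vadd {b : ℝ} (hH : H.IsAffineHovel) (hO : H.IsOrdered) (hf : H.IsChart f)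
    (hg : H.IsChart g) (hv : D.IsComparable v) (hp : f p = g p) (hb : 0 ≤ b)
    (hq : f (v +ᵥ p) = g (b • v +ᵥ p)) : f (v +ᵥ p) = g (v +ᵥ p) := by
  rcases eq_or_ne v 0 with rfl | hv0
  · rwa [zero_vadd]
  suffices hP : ∀ t : ℝ, 0 ≤ t → t ≤ 1 → f (t • v +ᵥ p) = g (t • v +ᵥ p) by
    simpa only [one_smul] using hP 1 zero_le_one le_rfl
  intro t ht
  refine real_induction (P := fun t => t ≤ 1 → f (t • v +ᵥ p) = g (t • v +ᵥ p))
    (fun _ => by rwa [zero_smul, zero_vadd]) (fun t ht hPt => ?_) (fun t ht hPt ht1 => ?_) ht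
  · rcases le_or_gt 1 t with ht1 | ht1
    · exact eventually_mem_nhdsWithin.mono fun s hs hs1 => absurd hs1 (ht1.trans_lt hs).not_ge
    have hray := eventuallyEq_rayGerm_smul_vadd hH hO hf hg hv hv0 hp hb hq ⟨ht, ht1⟩
      (hPt ht1.le)
    rw [rayGerm_smul_vadd] at hray
    exact Eventually.mono hray fun s hs _ => hs
  · refine eq_of_eventuallyEq_rayGerm hH hf hg hv.neg (neg_ne_zero.2 hv0) ?_
    rw [rayGerm_smul_vadd_neg]
    exact eventually_map.2 (mem_of_superset (Ioo_mem_nhdsLT ht) fun s hs =>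
      hPt s ⟨hs.1.le, hs.2⟩ (hs.2.le.trans ht1))

theorem eq_of_eventuallyEq_rayGerm_vsub (hH : H.IsAffineHovel) (hO : H.IsOrdered)
    (hf : H.IsChart f) (hg : H.IsChart g) (hpq : D.IsComparable (q -ᵥ p))
    (h : f =ᶠ[rayGerm p (q -ᵥ p)] g) (hq : f q ∈ range g) : f q = g q := by
  have hray : ∀ᶠ t : ℝ in 𝓝[>] 0, f (t • (q -ᵥ p) +ᵥ p) = g (t • (q -ᵥ p) +ᵥ p) := h
  obtain ⟨t, ht, hft⟩ := (Eventually.and (Ioo_mem_nhdsGT one_pos) hray).exists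
  rcases eq_or_ne q p with rfl | hne
  · rwa [vsub_self, smul_zero, zero_vadd] at hft
  have hp : f p = g p := eq_of_eventuallyEq_rayGerm hH hf hg hpq (vsub_ne_zero.2 hne) h
  obtain ⟨q', hq'⟩ := hq
  rw [← vsub_vadd q p, ← vsub_vadd q' p] at hq'
  obtain ⟨s, hs, hfs⟩ := hO.exists_eq_smul_vadd hf hg hpq hp hq'.symm (Ioo_subset_Icc_self ht)
  have hts : t • (q -ᵥ p) = s • (q' -ᵥ p) :=
    vadd_right_cancel p (hg.injective (hft.symm.trans hfs))
  have hs0 : s ≠ 0 := by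
    rintro rfl
    rw [zero_smul, smul_eq_zero_iff_right ht.1.ne', vsub_eq_zero_iff_eq] at hts
    exact hne hts
  have hq'v : q' -ᵥ p = (t / s) • (q -ᵥ p) := by
    rw [div_eq_inv_mul, mul_smul, hts, inv_smul_smul₀ hs0]
  rw [hq'v] at hq'
  have := eq_of_eq_smul_vadd hH hO hf hg hpq hp (div_nonneg ht.1.le hs.1) hq'.symm
  rwa [vsub_vadd] at this

theorem eq_of_eventuallyEq_rayGerm_of_isRegular (hH : H.IsAffineHovel) (hf : H.IsChart f)
    (hg : H.IsChart g) (hfg : range f = range g) (he : D.IsRegular e)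
    (h : f =ᶠ[rayGerm p e] g) : f = g := by
  obtain ⟨w, hw, rfl⟩ := hg.exists_weyl hf hfg
  have hwp : w p = p := hg.injective (eq_of_eventuallyEq_rayGerm hH hf hg
    (he.isComparable SimpleRoots.self_mem_closedChamber) he.1 h)
  have hray : ∀ᶠ t : ℝ in 𝓝[>] 0, g (w (t • e +ᵥ p)) = g (t • e +ᵥ p) := h
  obtain ⟨t, ht, hgt⟩ := (eventually_mem_nhdsWithin.and hray).exists
  have hwe : w.linear e = e := by
    have := hg.injective hgt
    rw [AffineEquiv.map_vadd, hwp, map_smul] at this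
    exact smul_right_injective V (ne_of_gt ht) (vadd_right_cancel p this)
  have hlin := VectorialDatum.eq_one_of_apply_eq_of_isRegular he (linear_mem_vectorialWeyl hw) hwe
  funext q
  have hwq : w q = q := by
    rw [← vsub_vadd q p, AffineEquiv.map_vadd, hwp, hlin, LinearEquiv.coe_one, id]
  exact congrArg g hwq

theorem IsIntrinsic.eventuallyEq (hF : H.IsIntrinsic F) (hH : H.IsAffineHovel)
    (hf : H.IsChart f) (hg : H.IsChart g) (he : D.IsRegular e)
    (hrange : ∀ᶠ p in F, f p ∈ range g) (hx : rayGerm x e ≤ D.enclosure F)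
    (h : f =ᶠ[rayGerm x e] g) : f =ᶠ[D.enclosure F] g := by
  obtain ⟨k, hk, hkg, hfk⟩ := hF hf hg hrange
  have hkg' : k = g := eq_of_eventuallyEq_rayGerm_of_isRegular hH hk hg hkg he
    ((hfk.filter_mono hx).symm.trans h)
  exact hkg' ▸ hfk

theorem eq_of_eventuallyEq_enclosure_rayGerm (hD : D.ModeratelyImaginary)
    (hH : H.IsAffineHovel) (hO : H.IsOrdered) (he : D.IsRegular e) (hf : H.IsChart f)
    (hg : H.IsChart g) (hfg : f =ᶠ[D.enclosure (rayGerm p e)] g)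
    (hq : p -ᵥ q ∈ D.closedChamber e) (hfq : f q ∈ range g) : f q = g q := by
  obtain ⟨t, ht, hfg⟩ := (eventually_mem_nhdsWithin.and
    (eventually_mem_enclosure_nhds_of_rayGerm hD he hfg)).exists
  refine eq_of_eventuallyEq_rayGerm_vsub hH hO hf hg ?_
    (Eventually.filter_mono (rayGerm_le_nhds.trans le_enclosure) hfg) hfq
  rw [← neg_vsub_eq_vsub_rev]
  exact (he.isComparable (smul_vadd_vsub_mem_closedChamber (le_of_lt ht) hq)).neg

theorem exists_isChart_of_eventuallyEq_rayGerm_neg (hD : D.ModeratelyImaginary)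
    (hH : H.IsAffineHovel) (hO : H.IsOrdered) (he : D.IsRegular e) (hj : H.IsChart j)
    (hh : H.IsChart h) (hjh : j =ᶠ[D.enclosure (rayGerm x (-e))] h) :
    ∃ k, H.IsChart k ∧ j =ᶠ[D.enclosure (D.sectorGerm o (-e) ⊔ pure x)] k ∧
      k =ᶠ[D.enclosure (rayGerm x e)] h := by
  obtain ⟨l, hl, hjl, hhl⟩ := hH.exists_chart hj hh (isSplayedChimneyGerm_sectorGerm he.neg)
    (Or.inl ⟨x, _, he.isVectorialFacet_chamber, rfl⟩)
  obtain ⟨k, hk, hkl, hhk⟩ := hH.isIntrinsic_rayGerm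
    (he.isComparable SimpleRoots.self_mem_closedChamber) he.1 x hh hl
    (hhl.filter_mono (rayGerm_le_facet he))
  have hhkx : h x = k x := hhk.filter_mono pure_le_enclosure_rayGerm
  have hjhx : j x = h x := hjh.filter_mono pure_le_enclosure_rayGerm
  obtain ⟨k', hk', hkk', hjk'⟩ := hH.isIntrinsic_sectorGerm_sup_pure hD he.neg hj hk
    (eventually_sup.2 ⟨hkl ▸ hjl, eventually_pure.2 ⟨x, (hjhx.trans hhkx).symm⟩⟩)
  suffices k = k' from ⟨k', hk', hjk', this ▸ hhk.symm⟩
  have hhk' : h =ᶠ[D.enclosure (rayGerm x (-e))] k' := hjh.symm.trans (hjk'.filter_mono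
    (enclosure_le_enclosure (rayGerm_le_enclosure_sectorGerm_sup_pure hD he.neg
      (vsub_self_mem_closedChamber x))))
  refine eq_of_eventuallyEq_rayGerm_of_isRegular hH hk hk' hkk'.symm he (p := x) ?_
  have hray : ∀ᶠ t : ℝ in 𝓝[>] 0, h (t • e +ᵥ x) = k (t • e +ᵥ x) :=
    hhk.filter_mono le_enclosure
  refine eventually_map.2 ((eventually_mem_nhdsWithin.and hray).mono fun t ⟨ht, hhkt⟩ => ?_)
  refine hhkt.symm.trans (eq_of_eventuallyEq_enclosure_rayGerm hD hH hO he.neg hh hk' hhk'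
    (vsub_smul_vadd_mem_closedChamber_neg (le_of_lt ht)) ?_)
  rw [hkk', hhkt]
  exact mem_range_self _

/-- Some chart joins the germ at infinity of the sectors of direction `-e` and the germ at `x` of
the ray of direction `e`, taken in `f`, to the germ of this ray at `x + te`, taken in `h`. -/
def IsLinked (H : ApartmentSystem D X) (f h : 𝔸 → X) (o x : 𝔸) (e : V) (t : ℝ) : Prop :=
  ∃ g, H.IsChart g ∧ f =ᶠ[D.enclosure (D.sectorGerm o (-e) ⊔ rayGerm x e)] g ∧
    g =ᶠ[D.enclosure (rayGerm (t • e +ᵥ x) e)] h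

theorem IsLinked.eventually_nhdsGT (hD : D.ModeratelyImaginary) (he : D.IsRegular e)
    (hlink : H.IsLinked f h o x e t) : ∀ᶠ s in 𝓝[>] t, H.IsLinked f h o x e s := by
  obtain ⟨g, hg, hfg, hgh⟩ := hlink
  rw [← zero_add t, ← map_add_right_nhdsGT, eventually_map]
  filter_upwards [eventually_mem_enclosure_nhds_of_rayGerm hD he hgh] with s hs
  rw [vadd_vadd, ← add_smul] at hs
  exact ⟨g, hg, hfg, Eventually.filter_mono
    (enclosure_le_enclosure (rayGerm_le_nhds.trans le_enclosure)) hs⟩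

theorem isLinked_of_forall_Ico (hD : D.ModeratelyImaginary) (hH : H.IsAffineHovel)
    (hO : H.IsOrdered) (he : D.IsRegular e) (hf : H.IsChart f) (hh : H.IsChart h) (ht : 0 < t)
    (hlink : ∀ s ∈ Ico 0 t, H.IsLinked f h o x e s) : H.IsLinked f h o x e t := by
  obtain ⟨l, hl, hfl, hhl⟩ := hH.exists_chart hf hh (isSplayedChimneyGerm_sectorGerm he.neg)
    (Or.inl ⟨t • e +ᵥ x, _, he.neg.isVectorialFacet_chamber, rfl⟩)
  obtain ⟨j, hj, hjl, hhj⟩ := hH.isIntrinsic_rayGerm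
    (he.neg.isComparable SimpleRoots.self_mem_closedChamber) he.neg.1 _ hh hl
    (hhl.filter_mono (rayGerm_le_facet he.neg))
  have hfj : f =ᶠ[D.enclosure (D.sectorGerm o (-e) ⊔ rayGerm x e)] j := by
    obtain ⟨s, hs, hhjs⟩ := (Eventually.and (Ioo_mem_nhdsGT ht)
      (eventually_mem_enclosure_nhds_of_rayGerm hD he.neg hhj)).exists
    obtain ⟨g, hg, hfg, hgh⟩ := hlink (t - s) ⟨sub_nonneg.2 hs.2.le, sub_lt_self t hs.1⟩
    rw [vadd_vadd, smul_neg, neg_add_eq_sub, ← sub_smul] at hhjs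
    have hgj : g =ᶠ[rayGerm ((t - s) • e +ᵥ x) e] j :=
      (hgh.filter_mono le_enclosure).trans
        (Eventually.filter_mono (rayGerm_le_nhds.trans le_enclosure) hhjs)
    have hgS : ∀ᶠ p in D.sectorGerm o (-e), g p ∈ range j := by
      filter_upwards [hfl, hfg.filter_mono (le_sup_left.trans le_enclosure)] with p hp hfgp
      rwa [hjl, ← hfgp]
    have hrange : ∀ᶠ p in D.sectorGerm o (-e) ⊔ rayGerm ((t - s) • e +ᵥ x) e, g p ∈ range j :=
      eventually_sup.2 ⟨hgS, hgj.mono fun p hp => ⟨p, hp.symm⟩⟩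
    refine hfg.trans (((hH.isIntrinsic_sectorGerm_sup_rayGerm hD he.neg he).eventuallyEq hH hg hj
      he hrange (le_sup_right.trans le_enclosure) hgj).filter_mono (enclosure_le_enclosure ?_))
    exact sectorGerm_neg_sup_rayGerm_le_enclosure_rayGerm hD he (sub_nonneg.2 hs.2.le)
  obtain ⟨k, hk, hjk, hkh⟩ := exists_isChart_of_eventuallyEq_rayGerm_neg hD hH hO he hj hh hhj.symm
  exact ⟨k, hk, hfj.trans (hjk.filter_mono (enclosure_le_enclosure
    (sectorGerm_neg_sup_rayGerm_le_enclosure_pure hD he ht))), hkh⟩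

theorem isLinked_of_eventuallyEq (hD : D.ModeratelyImaginary) (hH : H.IsAffineHovel)
    (hO : H.IsOrdered) (he : D.IsRegular e) (hf : H.IsChart f) (hh : H.IsChart h)
    (hfh : f =ᶠ[D.enclosure (rayGerm x e)] h) (ht : 0 ≤ t) : H.IsLinked f h o x e t :=
  real_induction ⟨f, hf, EventuallyEq.rfl, by rwa [zero_smul, zero_vadd]⟩
    (fun _ _ hlink => hlink.eventually_nhdsGT hD he)
    (fun _ ht hlink => isLinked_of_forall_Ico hD hH hO he hf hh ht hlink) ht

theorem exists_isChart_opposite (hD : D.ModeratelyImaginary) (hH : H.IsAffineHovel)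
    (hO : H.IsOrdered) (he : D.IsRegular e) (hf : H.IsChart f) (hh : H.IsChart h)
    (hfh : f =ᶠ[D.enclosure (rayGerm x e)] h) (o : 𝔸) :
    ∃ g, H.IsChart g ∧ f =ᶠ[D.enclosure (D.sectorGerm o (-e) ⊔ rayGerm x e)] g ∧
      (∀ᶠ p in D.sectorGerm o e, h p ∈ range g) ∧
        ∃ t : ℝ, 0 ≤ t ∧ g =ᶠ[rayGerm (t • e +ᵥ x) e] h := by
  obtain ⟨l, hl, hfl, hhl⟩ := hH.exists_chart hf hh (isSplayedChimneyGerm_sectorGerm he.neg)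
    (Or.inr (isSolidChimneyGerm_sectorGerm he))
  obtain ⟨t, hhlt, ht⟩ := ((eventually_mem_enclosure_nhds_of_sectorGerm he hhl x).and
    (eventually_ge_atTop 0)).exists
  obtain ⟨k, hk, hfk, hkh⟩ := isLinked_of_eventuallyEq (o := o) hD hH hO he hf hh hfh ht
  have hkS : ∀ᶠ p in D.sectorGerm o (-e), k p ∈ range l := by
    filter_upwards [hfl, hfk.filter_mono (le_sup_left.trans le_enclosure)] with p hp hfkp
    rwa [← hfkp]
  have hkR : ∀ᶠ p in rayGerm (t • e +ᵥ x) e, k p ∈ range l := by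
    filter_upwards [hkh.filter_mono le_enclosure,
      Eventually.filter_mono (rayGerm_le_nhds.trans le_enclosure) hhlt] with p hkhp hp
    rwa [hkhp]
  obtain ⟨g, hg, hgl, hkg⟩ :=
    hH.isIntrinsic_sectorGerm_sup_rayGerm hD he.neg he hk hl (eventually_sup.2 ⟨hkS, hkR⟩)
  refine ⟨g, hg, hfk.trans (hkg.filter_mono (enclosure_le_enclosure
    (sectorGerm_neg_sup_rayGerm_le_enclosure_rayGerm hD he ht))), hgl ▸ hhl, t, ht, ?_⟩
  exact (hkg.symm.filter_mono (le_sup_right.trans le_enclosure)).trans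
    (hkh.filter_mono le_enclosure)

theorem eventuallyEq_enclosure_pair (hD : D.ModeratelyImaginary) (hH : H.IsAffineHovel)
    (hO : H.IsOrdered) (he : D.IsRegular e) (hf : H.IsChart f) (hh : H.IsChart h)
    (hfh : f =ᶠ[D.enclosure (rayGerm x e)] h) (hxy : x -ᵥ y ∈ D.closedChamber e)
    (hy : f y = h y) : f =ᶠ[D.enclosure (𝓟 {x, y})] h := by
  obtain ⟨g, hg, hfg, hhg, t, ht, hgh⟩ := exists_isChart_opposite hD hH hO he hf hh hfh x
  have hpair : 𝓟 {x, y} ≤ D.enclosure (D.sectorGerm x (-e) ⊔ rayGerm x e) := by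
    refine (principal_pair_le_enclosure_sectorGerm_sup_pure hD he.neg ?_).trans
      (enclosure_le_enclosure (sup_le (le_sup_left.trans le_enclosure)
        (pure_le_enclosure_rayGerm.trans (enclosure_le_enclosure
          (le_sup_right.trans le_enclosure)))))
    rwa [← SimpleRoots.neg_mem_closedChamber, neg_vsub_eq_vsub_rev]
  have hfgxy : f =ᶠ[D.enclosure (𝓟 {x, y})] g := hfg.filter_mono (enclosure_le_enclosure hpair)
  have hfgxy' : ∀ p ∈ ({x, y} : Set 𝔸), f p = g p := hfgxy.filter_mono le_enclosure
  have hfgy : f y = g y := hfgxy' y (mem_insert_of_mem x rfl)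
  have hhgy : h =ᶠ[D.enclosure (D.sectorGerm x e ⊔ pure y)] g :=
    (hH.isIntrinsic_sectorGerm_sup_pure hD he).eventuallyEq hH hh hg he
      (eventually_sup.2 ⟨hhg, eventually_pure.2 ⟨y, hfgy.symm.trans hy⟩⟩)
      (rayGerm_le_enclosure_sectorGerm_sup_pure hD he (smul_vadd_vsub_mem_closedChamber ht hxy))
      hgh.symm
  refine hfgxy.trans (hhgy.symm.filter_mono (enclosure_le_enclosure ?_))
  rw [pair_comm]
  exact principal_pair_le_enclosure_sectorGerm_sup_pure hD he hxy

theorem exists_isChart_eq_pair (hH : H.IsAffineHovel) (hO : H.IsOrdered) (hf : H.IsChart f)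
    (hg : H.IsChart g) (hx : f x ∈ range g) (hy : f y ∈ range g)
    (hxy : D.IsComparable (y -ᵥ x)) :
    ∃ k, H.IsChart k ∧ range k = range g ∧ f x = k x ∧ f y = k y := by
  obtain ⟨j, hj, hjg, hfj⟩ := hH.isIntrinsic_pure x hf hg hx
  have hfjx : f x = j x := hfj.filter_mono le_enclosure
  rcases eq_or_ne y x with rfl | hne
  · exact ⟨j, hj, hjg, hfjx, hfjx⟩
  obtain ⟨y', hy'⟩ := hjg ▸ hy
  have hray : ∀ᶠ p in rayGerm x (y -ᵥ x), f p ∈ range g := by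
    refine eventually_map.2 (mem_of_superset (Ioo_mem_nhdsGT one_pos) fun t ht => ?_)
    obtain ⟨s, -, hfs⟩ := hO.exists_eq_smul_vadd (v' := y' -ᵥ x) hf hj hxy hfjx
      (by rw [vsub_vadd, vsub_vadd, hy']) (Ioo_subset_Icc_self ht)
    exact hjg ▸ ⟨_, hfs.symm⟩
  obtain ⟨k, hk, hkg, hfk⟩ := hH.isIntrinsic_rayGerm hxy (vsub_ne_zero.2 hne) x hf hg hray
  exact ⟨k, hk, hkg, hfk.filter_mono pure_le_enclosure_rayGerm,
    eq_of_eventuallyEq_rayGerm_vsub hH hO hf hk hxy (hfk.filter_mono le_enclosure) (hkg ▸ hy)⟩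

theorem isIntrinsic_pair_of_mem_closedChamber (hD : D.ModeratelyImaginary)
    (hH : H.IsAffineHovel) (hO : H.IsOrdered) (he : D.IsRegular e)
    (hxy : x -ᵥ y ∈ D.closedChamber e) : H.IsIntrinsic (𝓟 {x, y}) := by
  intro f g hf hg hrange
  have hyx : y -ᵥ x ∈ D.closedChamber (-e) := by
    rwa [← SimpleRoots.neg_mem_closedChamber, neg_vsub_eq_vsub_rev]
  obtain ⟨k, hk, hkg, hfkx, hfky⟩ := exists_isChart_eq_pair hH hO hf hg
    (hrange (mem_insert x _)) (hrange (mem_insert_of_mem x rfl)) (he.neg.isComparable hyx)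
  obtain ⟨l₀, hl₀, hkl₀, hfl₀⟩ := hH.exists_chart hk hf (isSplayedChimneyGerm_sectorGerm he.neg)
    (Or.inl ⟨x, _, he.isVectorialFacet_chamber, rfl⟩) (F := D.sectorGerm x (-e))
  obtain ⟨l, hl, hll₀, hfl⟩ := hH.isIntrinsic_rayGerm
    (he.isComparable SimpleRoots.self_mem_closedChamber) he.1 x hf hl₀
    (hfl₀.filter_mono (rayGerm_le_facet he))
  have hflx : f x = l x := hfl.filter_mono pure_le_enclosure_rayGerm
  obtain ⟨m, hm, hml, hkm⟩ := hH.isIntrinsic_sectorGerm_sup_pure hD he.neg hk hl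
    (eventually_sup.2 ⟨hll₀ ▸ hkl₀, eventually_pure.2 ⟨x, hflx.symm.trans hfkx⟩⟩)
  have hkmxy : k =ᶠ[D.enclosure (𝓟 {x, y})] m := hkm.filter_mono (enclosure_le_enclosure
    (principal_pair_le_enclosure_sectorGerm_sup_pure hD he.neg hyx))
  have hkmxy' : ∀ p ∈ ({x, y} : Set 𝔸), k p = m p := hkmxy.filter_mono le_enclosure
  have hfly : f y = l y := by
    refine eq_of_eventuallyEq_enclosure_rayGerm hD hH hO he hf hl hfl hxy ?_
    rw [hfky, hkmxy' y (mem_insert_of_mem x rfl), ← hml]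
    exact mem_range_self y
  obtain ⟨k', hk', hkk', hfk'⟩ := exists_isChart_eventuallyEq_of_eqOn hk hl hm hml.symm
    (eventuallyEq_enclosure_pair hD hH hO he hf hl hfl hxy hfly) hkmxy
    (by rintro p (rfl | rfl); exacts [hfkx, hfky])
  exact ⟨k', hk', hkk'.trans hkg, hfk'⟩

theorem isIntrinsic_pair_of_le (hD : D.ModeratelyImaginary) (hH : H.IsAffineHovel)
    (hO : H.IsOrdered) (hxy : D.Le x y) : H.IsIntrinsic (𝓟 {x, y}) := by
  rcases eq_or_ne x y with rfl | hne
  · rw [pair_eq_singleton, principal_singleton]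
    exact hH.isIntrinsic_pure x
  have : Nontrivial V := nontrivial_of_ne _ _ (vsub_ne_zero.2 hne)
  obtain ⟨e, he0, he⟩ := SimpleRoots.exists_ne_zero_root_pos D.toSimpleRoots
  obtain ⟨w, hw, u, hu, hwu⟩ := SimpleRoots.exists_dominant_of_mem_titsCone hxy
  obtain ⟨g, hg, rfl⟩ := exists_mem_weyl_linear_eq hw
  have hpair : map g (𝓟 {g.symm x, u +ᵥ g.symm x}) = 𝓟 {x, y} := by
    rw [map_principal, image_pair, AffineEquiv.map_vadd, AffineEquiv.apply_symm_apply, hwu,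
      vsub_vadd]
  have he' : D.IsRegular e := ⟨he0, Or.inl he⟩
  rw [← hpair]
  refine (isIntrinsic_pair_of_mem_closedChamber hD hH hO he'.neg ?_).map hg
  rw [vsub_vadd_eq_vsub_sub, vsub_self, zero_sub, SimpleRoots.neg_mem_closedChamber, neg_neg]
  exact fun i => mul_nonneg (he i).le (hu i)

theorem exists_rel_and_exists_iso (hD : D.ModeratelyImaginary) (hH : H.IsAffineHovel)
    (hO : H.IsOrdered) (hA : A ∈ H.apartments) (hA' : A' ∈ H.apartments) {a b : X}
    (ha : a ∈ A') (hb : b ∈ A') {r : 𝔸 → 𝔸 → Prop} (hr : ∀ p q, r p q → D.Le p q)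
    (hab : ∃ e ∈ H.isom A, ∃ p q, (e p : X) = a ∧ (e q : X) = b ∧ r p q) :
    (∃ e ∈ H.isom A', ∃ p q, (e p : X) = a ∧ (e q : X) = b ∧ r p q) ∧
      ∃ φ : A ≃ A', H.IsIso A A' φ ∧ Fixes φ (H.enclosure A (𝓟 (H.segmentIn A a b))) := by
  obtain ⟨e, he, p, q, hp, hq, hpq⟩ := hab
  obtain ⟨f, hf, rfl, rfl, rfl⟩ : ∃ f, H.IsChart f ∧ range f = A ∧ f p = a ∧ f q = b :=
    ⟨_, ⟨A, hA, e, he, rfl⟩, range_isom e, hp, hq⟩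
  obtain ⟨e₀, he₀⟩ := H.isom_nonempty A' hA'
  obtain ⟨k, hk, hkA', hfk⟩ := isIntrinsic_pair_of_le hD hH hO (hr p q hpq) hf
    ⟨A', hA', e₀, he₀, rfl⟩ (by rw [range_isom]; rintro c (rfl | rfl); exacts [ha, hb])
  rw [range_isom] at hkA'
  have hfk' : EqOn f k {p, q} := hfk.filter_mono le_enclosure
  constructor
  · obtain rfl := hkA'
    obtain ⟨e', he', hke⟩ := hk.exists_isom
    have he'k : ∀ c ∈ ({p, q} : Set 𝔸), (e' c : X) = f c := fun c hc =>
      (congrFun hke c).symm.trans (hfk' hc).symm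
    exact ⟨e', he', p, q, he'k p (mem_insert p _), he'k q (mem_insert_of_mem p rfl), hpq⟩
  · rw [hf.segmentIn_eq, ← map_principal]
    exact (hf.exists_iso_fixes_iff hA').2 ⟨k, hk, hkA',
      hfk.filter_mono (enclosure_le_enclosure principal_affineSegment_le_enclosure)⟩

theorem leIn_and_exists_iso (hD : D.ModeratelyImaginary) (hH : H.IsAffineHovel)
    (hO : H.IsOrdered) (hA : A ∈ H.apartments) (hA' : A' ∈ H.apartments) {a b : X} (ha : a ∈ A')
    (hb : b ∈ A') (hab : H.LeIn A a b) :
    H.LeIn A' a b ∧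
      ∃ φ : A ≃ A', H.IsIso A A' φ ∧ Fixes φ (H.enclosure A (𝓟 (H.segmentIn A a b))) :=
  exists_rel_and_exists_iso hD hH hO hA hA' ha hb (fun _ _ => id) hab

theorem openLeIn_and_exists_iso (hD : D.ModeratelyImaginary) (hH : H.IsAffineHovel)
    (hO : H.IsOrdered) (hA : A ∈ H.apartments) (hA' : A' ∈ H.apartments) {a b : X} (ha : a ∈ A')
    (hb : b ∈ A') (hab : H.OpenLeIn A a b) :
    H.OpenLeIn A' a b ∧
      ∃ φ : A ≃ A', H.IsIso A A' φ ∧ Fixes φ (H.enclosure A (𝓟 (H.segmentIn A a b))) :=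
  exists_rel_and_exists_iso hD hH hO hA hA' ha hb (fun _ _ => OpenLe.le) hab

end ApartmentSystem

end Hovel

open Hovel in
theorem proposition5p4 {V 𝔸 I X : Type*} [NormedAddCommGroup V] [NormedSpace ℝ V]
    [FiniteDimensional ℝ V] [MetricSpace 𝔸] [NormedAddTorsor V 𝔸] [Fintype I]
    (D : ModelApartment V 𝔸 I) (hD : D.ModeratelyImaginary)
    (H : ApartmentSystem D X) (hH : H.IsAffineHovel) (hO : H.IsOrdered) :
    (∀ A₁ ∈ H.apartments, ∀ A₂ ∈ H.apartments, ∀ x ∈ A₁ ∩ A₂, ∀ y ∈ A₁ ∩ A₂, x ≠ y →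
      (H.LeIn A₁ x y → H.LeIn A₂ x y ∧ ∃ φ : A₁ ≃ A₂, H.IsIso A₁ A₂ φ ∧
        ApartmentSystem.Fixes φ (H.enclosure A₁ (Filter.principal (H.segmentIn A₁ x y)))) ∧
      (H.OpenLeIn A₁ x y → H.OpenLeIn A₂ x y ∧ ∃ φ : A₁ ≃ A₂, H.IsIso A₁ A₂ φ ∧
        ApartmentSystem.Fixes φ (H.enclosure A₁ (Filter.principal (H.segmentIn A₁ x y))))) ∧
    (∀ A ∈ H.apartments, ∀ x ∈ A, ∀ y ∈ A,
      (H.Le x y ↔ H.LeIn A x y) ∧ (H.OpenLe x y ↔ H.OpenLeIn A x y)) := by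
  refine ⟨fun A₁ hA₁ A₂ hA₂ x hx y hy _ =>
    ⟨ApartmentSystem.leIn_and_exists_iso hD hH hO hA₁ hA₂ hx.2 hy.2,
      ApartmentSystem.openLeIn_and_exists_iso hD hH hO hA₁ hA₂ hx.2 hy.2⟩,
    fun A hA x hx y hy => ⟨⟨?_, fun h => ⟨A, hA, h⟩⟩, ⟨?_, fun h => ⟨A, hA, h⟩⟩⟩⟩
  · rintro ⟨A', hA', h⟩
    exact (ApartmentSystem.leIn_and_exists_iso hD hH hO hA' hA hx hy h).1
  · rintro ⟨A', hA', h⟩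
    exact (ApartmentSystem.openLeIn_and_exists_iso hD hH hO hA' hA hx hy h).1
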